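/- Let $n\ge2$, let $X_n$ be one of $B_n,C_n,D_n$ (underlying the affine type $B_n^{(1)},A_{2n-1}^{(2)},D_n^{(1)}$, respectively), and let $1\le r\le n-1$, $1\le r\le n$, $1\le r\le n-2$, respectively, and $k,l\ge1$. Let $I_0=\{1,\dots,n\}$. As an $X_n$-crystal, the Kirillov–Reshetikhin crystal is $B^{r,k}=\bigoplus_\Lambda B(\Lambda)$, where $\Lambda$ runs over the Young diagrams obtained from the rectangle with $k$ columns of height $r$ by removing vertical dominoes, and the elements of $B(\Lambda)$ are represented by the Kashiwara–Nakashima tableaux of shape $\Lambda$ (French notation, rows numbered from the bottom). The Kashiwara operators $e_i,f_i$ ($i\in I_0$) act on a tableau through its reading word (columns from right to left, each from bottom to top), regarded as an element of a tensor power of the crystal $B(\Lambda_1)$ of the vector representation. For a tensor product, $e_i(b\otimes b')=e_ib\otimes b'$ if $\varphi_i(b)\ge\varepsilon_i(b')$ and $e_i(b\otimes b')=b\otimes e_ib'$ otherwise; $f_i(b\otimes b')=f_ib\otimes b'$ if $\varphi_i(b)>\varepsilon_i(b')$ and $f_i(b\otimes b')=b\otimes f_ib'$ otherwise. An element of a crystal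 is called $I_0$-highest if all $e_i$ with $i\in I_0$ send it to $0$. Let $1^l\in B^{1,l}$ be the one-row tableau with $l$ entries $1$. A $\pm$-diagram $P$ is a chain of partitions $\lambda\subset\mu\subset\Lambda$ such that $\mu/\lambda$ and $\Lambda/\mu$ are horizontal strips; the cells of $\mu/\lambda$ are filled with $+$ and those of $\Lambda/\mu$ with $-$. In type $C_n$ one also requires that $\Lambda$ has no column of height more than $n$ and that $\lambda$ has no column of height $n$. We call $\Lambda$ the outer shape of $P$. The tableau $\Phi(P)$, of shape $\Lambda$, is defined as follows. Each column of height $n$ with a $+$ at height $n$ is filled with $1,2,\dots,n$ and is not changed any more. In the other columns put $\bar1$ in each cell containing $-$ and fill the rest of the column from the bottom by $2,3,\dots,m$. Then take the symbols $+$ of $P$ from left to right, ignoring those at height $n$, and move through these columns from left to right, and through each column from top to bottom. Each time a letter $\bar1$ or a string $2\,3\cdots m$ starting with $2$ is met, it is altered by the next unused $+$, if there is one: if this $+$ is at height $h$, then $\bar1$ is replaced by $\overline{h+1}$, and $2\,3\cdots m$ by $1\,2\cdots h\;h{+}2\cdots m$. For $i\ge1$ let $p_i^{\cdot}$, $p_i^{-}$,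 $p_i^{\mp}$ be the number of columns of height $i$ of the outer shape of $P$ that contain, respectively, no sign, only a $-$, and both a $+$ and a $-$. **Proposition.** An element $b\otimes b'$ of $B^{1,l}\otimes B^{r,k}$ is $I_0$-highest if and only if $b=1^l$ and $b'=\Phi(P)$ for some $\pm$-diagram $P$, whose outer shape is one of the shapes $\Lambda$ occurring in $B^{r,k}$, such that \[ \sum_{\substack{1\le i\le r\\ i\equiv r\ (2)}}\bigl(p_i^{\cdot}+p_i^{-}\bigr)+\sum_{\substack{1<i\le r\\ i\equiv r\ (2)}}\bigl(p_i^{-}+p_i^{\mp}\bigr)\le l . \] -/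

import Mathlib

namespace KRCrystal

/-! ### Crystals (the Kashiwara operators only; `none` plays the role of the symbol zero) -/

/-- The underlying coloured graph of a crystal with index set `I`: a set with operators
`e i, f i : B → B ∪ {0}`. (Weights are not needed to speak of highest elements.) -/
structure Crystal (I : Type) where
  Elt : Type
  e : I → Elt → Option Elt
  f : I → Elt → Option Elt

namespace Crystal

variable {I : Type}

/-- `ε_i(b) = max {k | e_i^k b ≠ 0}`. -/
noncomputable def eps (C : Crystal I) (i : I) (b : C.Elt) : ℕ :=
  sSup {k : ℕ | (fun x : Option C.Elt => x.bind (C.e i))^[k] (some b) ≠ none}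

/-- `φ_i(b) = max {k | f_i^k b ≠ 0}`. -/
noncomputable def phi (C : Crystal I) (i : I) (b : C.Elt) : ℕ :=
  sSup {k : ℕ | (fun x : Option C.Elt => x.bind (C.f i))^[k] (some b) ≠ none}

/-- The tensor product `C ⊗ D`:
`e_i (b ⊗ b') = e_i b ⊗ b'` if `φ_i(b) ≥ ε_i(b')` and `b ⊗ e_i b'` otherwise;
`f_i (b ⊗ b') = f_i b ⊗ b'` if `φ_i(b) > ε_i(b')` and `b ⊗ f_i b'` otherwise. -/
noncomputable def tensor (C D : Crystal I) : Crystal I where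
  Elt := C.Elt × D.Elt
  e i b :=
    if D.eps i b.2 ≤ C.phi i b.1 then (C.e i b.1).map (fun c => (c, b.2))
    else (D.e i b.2).map (fun d => (b.1, d))
  f i b :=
    if D.eps i b.2 < C.phi i b.1 then (C.f i b.1).map (fun c => (c, b.2))
    else (D.f i b.2).map (fun d => (b.1, d))

/-- The one-element crystal, the unit for the tensor product. -/
def unit (I : Type) : Crystal I where
  Elt := Unit
  e _ _ := none
  f _ _ := none

/-- The tensor power `C ⊗ (C ⊗ (⋯ ⊗ (C ⊗ unit)))`. -/
noncomputable def pow (C : Crystal I) : ℕ → Crystal I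
  | 0 => unit I
  | N + 1 => tensor C (C.pow N)

/-- A word `a₁ a₂ ⋯ a_N` as the element `a₁ ⊗ a₂ ⊗ ⋯ ⊗ a_N` of the `N`-th tensor power. -/
def ofWord (C : Crystal I) : (w : List C.Elt) → (C.pow w.length).Elt
  | [] => ()
  | a :: w => (a, C.ofWord w)

/-- `b` is `S`-highest: `e_i b = 0` for all `i ∈ S`. -/
def IsHighest (C : Crystal I) (S : Set I) (b : C.Elt) : Prop :=
  ∀ i ∈ S, C.e i b = none

end Crystal

/-! ### The crystal of the vector representation in types `B_n`, `C_n`, `D_n` -/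

/-- The type `X_n` of the finite-dimensional Lie algebra: `B_n`, `C_n`, `D_n` underlies the affine
type `B_n^{(1)}`, `A_{2n-1}^{(2)}`, `D_n^{(1)}`, respectively. -/
inductive ClassicalType
  | B | C | D
  deriving DecidableEq

/-- `pos i` is the letter `i`, `neg i` is the barred letter, `zero` is the letter `0` of
type `B`. -/
inductive Letter
  | pos (i : ℕ)
  | zero
  | neg (i : ℕ)
  deriving DecidableEq

/-- The letters of the alphabet of type `X_n`. -/
def Letter.Valid (X : ClassicalType) (n : ℕ) : Letter → Prop
  | .pos i => 1 ≤ i ∧ i ≤ n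
  | .zero => X = .B
  | .neg i => 1 ≤ i ∧ i ≤ n

/-- The strict order `1 < 2 < ⋯ < n < 0 < n̄ < ⋯ < 1̄` (without `0` unless the type is `B`); in
type `D` the letters `n` and `n̄` are incomparable. -/
def Letter.LT (X : ClassicalType) (n : ℕ) : Letter → Letter → Prop
  | .pos i, .pos j => i < j
  | .pos _, .zero => True
  | .pos i, .neg j => ¬ (X = .D ∧ i = n ∧ j = n)
  | .zero, .neg _ => True
  | .neg i, .neg j => j < i
  | _, _ => False

/-- The arrows `a → f_i a`, `i = 1, …, n`: `i → i+1` and `(i+1)‾ → i‾` for `i < n`, and for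
`i = n`: `n → 0 → n̄` (type `B`), `n → n̄` (type `C`), `n-1 → n̄` and `n → (n-1)‾` (type `D`). -/
def vectorF (X : ClassicalType) (n i : ℕ) (a : Letter) : Option Letter :=
  if 1 ≤ i ∧ i < n then
    match a with
    | .pos j => if j = i then some (.pos (i + 1)) else none
    | .zero => none
    | .neg j => if j = i + 1 then some (.neg i) else none
  else if i = n then
    match X, a with
    | .B, .pos j => if j = n then some .zero else none
    | .B, .zero => some (.neg n)
    | .C, .pos j => if j = n then some (.neg n) else none
    | .D, .pos j =>
        if j = n - 1 then some (.neg n) else if j = n then some (.neg (n - 1)) else none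
    | _, _ => none
  else none

/-- The inverse arrows `a → e_i a`. -/
def vectorE (X : ClassicalType) (n i : ℕ) (a : Letter) : Option Letter :=
  if 1 ≤ i ∧ i < n then
    match a with
    | .pos j => if j = i + 1 then some (.pos i) else none
    | .zero => none
    | .neg j => if j = i then some (.neg (i + 1)) else none
  else if i = n then
    match X, a with
    | .B, .neg j => if j = n then some .zero else none
    | .B, .zero => some (.pos n)
    | .C, .neg j => if j = n then some (.pos n) else none
    | .D, .neg j =>
        if j = n then some (.pos (n - 1)) else if j = n - 1 then some (.pos n) else none
    | _, _ => none
  else none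

/-- The crystal `B(Λ_1)` of the vector representation; the elements are the valid letters
(there are no arrows between valid and other letters). The colours that matter are `1, …, n`. -/
def vector (X : ClassicalType) (n : ℕ) : Crystal ℕ where
  Elt := Letter
  e := vectorE X n
  f := vectorF X n

/-! ### Kashiwara–Nakashima tableaux (non-spin shapes)

A tableau is the list of its columns from left to right, each column being the list of its entries
from bottom to top (French notation: all columns start in the bottom row). Columns may be empty. -/

abbrev Tableau := List (List Letter)

/-- Condition on two entries of a column, the first just below the second: strictly increasing,
except that `0` may be repeated in type `B` and `n`, `n̄` may alternate in type `D`. -/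
def ColStep (X : ClassicalType) (n : ℕ) (x y : Letter) : Prop :=
  Letter.LT X n x y ∨ (X = .B ∧ x = .zero ∧ y = .zero) ∨
    (X = .D ∧ ((x = .pos n ∧ y = .neg n) ∨ (x = .neg n ∧ y = .pos n)))

/-- KN columns. The last condition is: if `a` is the entry in row `p` and `ā` the entry in row
`q > p` (rows numbered from `1`) of a column of height `N`, then `p + (N - q + 1) ≤ a`. -/
def IsKNColumn (X : ClassicalType) (n : ℕ) (C : List Letter) : Prop :=
  (∀ x ∈ C, Letter.Valid X n x) ∧ C.IsChain (ColStep X n) ∧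
  ∀ a ≤ n, ∀ q < C.length, ∀ p < q,
    C[p]? = some (.pos a) → C[q]? = some (.neg a) → (p + 1) + (C.length - (q + 1) + 1) ≤ a

/-- Condition on two neighbouring entries of a row: weakly increasing, `0` not repeated. -/
def RowStep (X : ClassicalType) (n : ℕ) (x y : Letter) : Prop :=
  Letter.LT X n x y ∨ (x = y ∧ x ≠ .zero)

/-- The vertical pairs (from bottom to top) that are the middle part of an `(a, n)`-configuration
in types `B` and `D`. -/
def MiddlePair (X : ClassicalType) (n : ℕ) (x y : Letter) : Prop :=
  match X with
  | .B => (x = .pos n ∨ x = .zero) ∧ (y = .zero ∨ y = .neg n)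
  | .C => False
  | .D => (x = .pos n ∧ y = .neg n) ∨ (x = .neg n ∧ y = .pos n)

/-- The condition on `(a, b)`-configurations, `a ≤ b` (with `b ≤ n` in type `C` and `b < n` in
types `B`, `D`), in the adjacent columns `L` (left) and `R` (right): whenever `a` is in row `p` of
`L`, `ā` in row `s` of `R`, and `b`, `b̄` are in rows `q < r` of the same column `L` or `R`, where
`p ≤ q < r ≤ s`, then `(q - p) + (s - r) < b - a`. -/
def ABCondition (X : ClassicalType) (n : ℕ) (L R : List Letter) : Prop :=
  ∀ b ≤ n, (X = .C ∨ b < n) → ∀ a ≤ b, ∀ s < R.length, ∀ r ≤ s, ∀ q < r, ∀ p ≤ q,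
    L[p]? = some (.pos a) → R[s]? = some (.neg a) →
    ((L[q]? = some (.pos b) ∧ L[r]? = some (.neg b)) ∨
      (R[q]? = some (.pos b) ∧ R[r]? = some (.neg b))) →
    (q - p) + (s - r) < b - a

/-- The condition on `(a, n)`-configurations, `a < n`, in types `B` and `D`: as above, but with a
middle pair of `L` or of `R` in the adjacent rows `q, q + 1`. -/
def ANCondition (X : ClassicalType) (n : ℕ) (L R : List Letter) : Prop :=
  ∀ a < n, ∀ s < R.length, ∀ q < s, ∀ p ≤ q,
    L[p]? = some (.pos a) → R[s]? = some (.neg a) →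
    (∃ C ∈ [L, R], ∃ x ∈ C[q]?, ∃ y ∈ C[q + 1]?, MiddlePair X n x y) →
    (q - p) + (s - (q + 1)) < n - a

/-- Type `B`: there are no rows `q < r` with `n` or `0` in row `q` of the left column and `0` or
`n̄` in row `r` of the right column. -/
def NConditionB (n : ℕ) (L R : List Letter) : Prop :=
  ∀ r < R.length, ∀ q < r,
    ¬ ((L[q]? = some (.pos n) ∨ L[q]? = some .zero) ∧
      (R[r]? = some .zero ∨ R[r]? = some (.neg n)))

/-- Type `D`: the condition on `a`-odd- and `a`-even-configurations, `a < n`. Whenever `a` is in row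
`p` of `L`, `ā` in row `s` of `R`, and `x ∈ {n, n̄}` is in row `q` of `R`, `y ∈ {n, n̄}` in row `r`
of `L`, where `p ≤ q < r ≤ s`, and either `r - q + 1` is odd and `x ≠ y` or `r - q + 1` is even and
`x = y`, then `s - p < n - a`. -/
def ParityConditionD (n : ℕ) (L R : List Letter) : Prop :=
  ∀ a < n, ∀ s < R.length, ∀ r ≤ s, ∀ q < r, ∀ p ≤ q,
    L[p]? = some (.pos a) → R[s]? = some (.neg a) →
    ∀ x ∈ R[q]?, ∀ y ∈ L[r]?, (x = .pos n ∨ x = .neg n) → (y = .pos n ∨ y = .neg n) →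
    ((Odd (r - q + 1) ∧ x ≠ y) ∨ (Even (r - q + 1) ∧ x = y)) →
    s - p < n - a

/-- Type `D`: no two adjacent rows in which both columns contain the same vertical pair
`n, n̄` or `n̄, n`. -/
def NConditionD (n : ℕ) (L R : List Letter) : Prop :=
  ∀ q < R.length,
    ¬ (L[q]? = some (.pos n) ∧ L[q + 1]? = some (.neg n) ∧
      R[q]? = some (.pos n) ∧ R[q + 1]? = some (.neg n)) ∧
    ¬ (L[q]? = some (.neg n) ∧ L[q + 1]? = some (.pos n) ∧
      R[q]? = some (.neg n) ∧ R[q + 1]? = some (.pos n))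

/-- The KN condition on two adjacent columns (left and right). -/
def IsKNPair (X : ClassicalType) (n : ℕ) (L R : List Letter) : Prop :=
  R.length ≤ L.length ∧
  (∀ z ∈ L.zip R, RowStep X n z.1 z.2) ∧
  ABCondition X n L R ∧
  ANCondition X n L R ∧
  (X = .B → NConditionB n L R) ∧
  (X = .D → ParityConditionD n L R ∧ NConditionD n L R)

/-- Kashiwara–Nakashima tableaux of type `X_n` (for shapes with columns of height at most `n - 1`,
`n`, `n - 2` in type `B`, `C`, `D`). -/
def IsKNTableau (X : ClassicalType) (n : ℕ) (T : Tableau) : Prop :=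
  (∀ C ∈ T, IsKNColumn X n C) ∧ T.IsChain (IsKNPair X n)

/-- The largest `r` for which `B^{r,k}` is considered. -/
def maxRow (X : ClassicalType) (n : ℕ) : ℕ :=
  match X with
  | .B => n - 1
  | .C => n
  | .D => n - 2

/-- The set underlying `B^{r,k} = ⨁_Λ B(Λ)`, the elements of `B(Λ)` being the KN tableaux of shape
`Λ`. The shapes `Λ` are those obtained from the `r × k` rectangle (`k` columns of height `r`) by
removing vertical dominoes, i.e. they have `k` columns (possibly empty ones) of height at most `r`
and congruent to `r` modulo `2`. -/
def KR (X : ClassicalType) (n r k : ℕ) : Set Tableau :=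
  {T | T.length = k ∧ (∀ C ∈ T, C.length ≤ r ∧ C.length ≡ r [MOD 2]) ∧ IsKNTableau X n T}

/-- Japanese reading word: columns from right to left, each column from bottom to top. -/
def Tableau.word (T : Tableau) : List Letter := T.reverse.flatten

/-- The crystal of words that contains the reading word of `T`; the operators `e_i, f_i`,
`1 ≤ i ≤ n`, act on a KN tableau through its reading word. -/
noncomputable def Tableau.ambient (X : ClassicalType) (n : ℕ) (T : Tableau) : Crystal ℕ :=
  (vector X n).pow T.word.length

/-- A tableau as the element `w₁ ⊗ w₂ ⊗ ⋯` of the crystal of words. -/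
def Tableau.read (X : ClassicalType) (n : ℕ) (T : Tableau) : (T.ambient X n).Elt :=
  (vector X n).ofWord T.word

/-- `b ⊗ b'` is `I₀`-highest, where `I₀ = {1, …, n}`. -/
def IsClassicallyHighest (X : ClassicalType) (n : ℕ) (b b' : Tableau) : Prop :=
  ((b.ambient X n).tensor (b'.ambient X n)).IsHighest (Set.Icc 1 n) (b.read X n, b'.read X n)

/-- The one-row tableau `1^l`. -/
def oneRow (l : ℕ) : Tableau := List.replicate l [.pos 1]

/-! ### `±`-diagrams -/

/-- A `±`-diagram: partitions `λ ⊆ μ ⊆ Λ` such that `Λ/μ` and `μ/λ` are horizontal strips (at most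
one cell in each column). The cells of `μ/λ` carry `+`, those of `Λ/μ` carry `-`. -/
structure PMDiagram where
  inner : YoungDiagram
  mid : YoungDiagram
  outer : YoungDiagram
  inner_le_mid : inner ≤ mid
  mid_le_outer : mid ≤ outer
  plus_strip : ∀ j, mid.colLen j ≤ inner.colLen j + 1
  minus_strip : ∀ j, outer.colLen j ≤ mid.colLen j + 1

namespace PMDiagram

variable (P : PMDiagram)

/-- Column `j` contains a `+` (in row `P.mid.colLen j`). -/
def HasPlus (j : ℕ) : Prop := P.inner.colLen j < P.mid.colLen j

/-- Column `j` contains a `-` (in the top row `P.outer.colLen j`). -/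
def HasMinus (j : ℕ) : Prop := P.mid.colLen j < P.outer.colLen j

instance (j : ℕ) : Decidable (P.HasPlus j) := inferInstanceAs (Decidable (_ < _))

instance (j : ℕ) : Decidable (P.HasMinus j) := inferInstanceAs (Decidable (_ < _))

/-- The additional requirement on `±`-diagrams in type `C_n`: the outer shape has columns of
height at most `n`, the inner shape has no column of height `n`. -/
def IsOfType (X : ClassicalType) (n : ℕ) : Prop :=
  X = .C → ∀ j, P.outer.colLen j ≤ n ∧ P.inner.colLen j < n

/-- The outer shape is one of the shapes `Λ` that occur in `B^{r,k}`. -/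
def OuterMem (r k : ℕ) : Prop :=
  (∀ j < k, P.outer.colLen j ≤ r ∧ P.outer.colLen j ≡ r [MOD 2]) ∧
    ∀ j, k ≤ j → P.outer.colLen j = 0

/-- `p_i^·`: the number of columns of the outer shape of height `i` without a sign. -/
def numEmpty (i : ℕ) : ℕ :=
  ((Finset.range (P.outer.rowLen 0)).filter
    (fun j => P.outer.colLen j = i ∧ ¬ P.HasPlus j ∧ ¬ P.HasMinus j)).card

/-- `p_i^-`: the number of columns of the outer shape of height `i` that contain `-` only. -/
def numMinus (i : ℕ) : ℕ :=
  ((Finset.range (P.outer.rowLen 0)).filter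
    (fun j => P.outer.colLen j = i ∧ ¬ P.HasPlus j ∧ P.HasMinus j)).card

/-- `p_i^∓`: the number of columns of the outer shape of height `i` that contain `+` and `-`. -/
def numBoth (i : ℕ) : ℕ :=
  ((Finset.range (P.outer.rowLen 0)).filter
    (fun j => P.outer.colLen j = i ∧ P.HasPlus j ∧ P.HasMinus j)).card

/-- The string `a, a + 1, …, b` (empty if `b < a`). -/
def string (a b : ℕ) : List Letter := (List.range' a (b + 1 - a)).map Letter.pos

/-- Processing a letter `1̄`, when `hs` is the list of the heights of the `+`'s that have not been
used yet: the next `+`, at height `h`, changes `1̄` into `(h+1)‾`. Returns the new letter and the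
remaining list. -/
def alterBar : List ℕ → Letter × List ℕ
  | [] => (.neg 1, [])
  | h :: hs => (.neg (h + 1), hs)

/-- Processing a string `2 3 ⋯ m`: if it contains a `2`, the next `+`, at height `h`, changes it
into `1 2 ⋯ h (h+2) ⋯ m`. -/
def alterString (m : ℕ) : List ℕ → List Letter × List ℕ
  | [] => (string 2 m, [])
  | h :: hs => if 2 ≤ m then (string 1 h ++ string (h + 2) m, hs) else (string 2 m, h :: hs)

/-- The columns of `Φ(P)`, given the list of the heights (outer, mid, inner) of the columns and the
list of the heights of the `+`'s not used yet. A column of height `n` with a `+` at height `n`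
becomes `1 2 ⋯ n`. Otherwise a column of height `o` is first filled by `2 ⋯ o 1̄` or by `2 ⋯ o (o+1)`
according to whether it contains a `-`, and is then altered from top to bottom. -/
def PhiAux (n : ℕ) : List (ℕ × ℕ × ℕ) → List ℕ → Tableau
  | [], _ => []
  | (o, m, i) :: cols, hs =>
    if m = n ∧ i < m then
      string 1 n :: PhiAux n cols hs
    else if m < o then
      let x := alterBar hs
      let s := alterString o x.2
      (s.1 ++ [x.1]) :: PhiAux n cols s.2
    else
      let s := alterString (o + 1) hs
      s.1 :: PhiAux n cols s.2

/-- The heights of the `+`'s among the first `k` columns, from left to right, ignoring the `+`'s at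
height `n`. -/
def plusHeights (n k : ℕ) : List ℕ :=
  ((List.range k).filter (fun j => P.HasPlus j ∧ P.mid.colLen j ≠ n)).map P.mid.colLen

/-- The map `Φ`, for `±`-diagrams with at most `k` columns; the tableau is written with exactly `k`
columns, the last ones of which may be empty. -/
def Phi (n k : ℕ) : Tableau :=
  PhiAux n
    ((List.range k).map (fun j => (P.outer.colLen j, P.mid.colLen j, P.inner.colLen j)))
    (P.plusHeights n k)

end PMDiagram

end KRCrystal

/-! Since ε(b ⊗ b') = ε(b) + max(0, ε(b') − φ(b)), the element b ⊗ b' is highest iff b is highest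
and ε_i(b') ≤ φ_i(b) for all i. The only highest b in B^{1,l} is 1^l, which has φ_1 = l and φ_i = 0
for i > 1. So it must be shown that the b' killed by e_2, …, e_n are the tableaux Φ(P), and that
ε_1(Φ(P)) ≤ l is the stated inequality.

Both halves rest on one encoding (`ColData`). A column of Φ(P) is 1 ⋯ h (h+2) ⋯ (m+1), possibly with
(g+1)‾ on top. Here m is the height of the column in the middle shape μ, and h, g are the heights of
the +'s that altered it, with 0 for a part left unaltered. Listed from left to right, g before h,
they form a weakly decreasing sequence, `heights`: the heights of the +'s followed by zeros. The
coefficient of ϵ_{x+1} in the weight is #{m ≥ x} − #{x in heights}, so the coefficients of ϵ_{x+1}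
and ϵ_{x+2} differ by #{m = x} − #{x in heights} + #{x+1 in heights} (`coeff_sub_coeff_word_tab`).

For i < n, ε_i is governed by the weights of prefixes of the word, and the word begins with the
rightmost columns, where the heights are smallest. Hence ε_{x+1} ≤ k becomes #{x in heights} ≤ #{m =
x} + k (`Bounded.neg_le_coeff`, `count_le_of_neg_le_coeff`). For x ≥ 1 and k = 0 this holds for
Φ(P), because the +'s at height x lie in columns of μ of height x. For x = 0, counting zeros column
by column gives exactly the level (`exists_colData_Phi`). The index n is covered by the
nonnegativity of the coefficient of ϵ_n.

Conversely, if e_2, …, e_n kill b', each letter must be supported by letters read earlier. Together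
with the Kashiwara–Nakashima conditions this forces the above form of the columns and the
monotonicity of the heights (`exists_good_of_leviHighest`). The inequality #{x in heights} ≤ #{m =
x} leaves room to place the required +'s at height x in the rightmost columns of μ of height x, and
Φ of the resulting diagram is b' (`exists_pmDiagram`). -/

namespace KRCrystal

/-! ### String lengths in tensor products and words -/

namespace Crystal

variable {I : Type}

/-- `E` and `F` measure the distances to the two ends of the `i`-strings of `C`. -/
structure StringLengths (C : Crystal I) (i : I) (E F : C.Elt → ℕ) : Prop where
  e_none : ∀ b, E b = 0 → C.e i b = none
  e_some : ∀ b, E b ≠ 0 → ∃ c, C.e i b = some c ∧ E b = E c + 1 ∧ F c = F b + 1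
  f_none : ∀ b, F b = 0 → C.f i b = none
  f_some : ∀ b, F b ≠ 0 → ∃ c, C.f i b = some c ∧ F b = F c + 1 ∧ E c = E b + 1

theorem iterate_bind_none {α : Type} (g : α → Option α) (k : ℕ) :
    (fun x : Option α => x.bind g)^[k] none = none := by
  induction k with
  | zero => rfl
  | succ k ih => rw [Function.iterate_succ_apply]; exact ih

/-- Each application lowers `E` by one and `none` is absorbing. This makes the supremum in `eps` and
`phi` one over an initial segment of ℕ. -/
theorem iterate_bind_ne_none_iff {α : Type} (g : α → Option α) (E : α → ℕ)
    (h0 : ∀ b, E b = 0 → g b = none)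
    (h1 : ∀ b, E b ≠ 0 → ∃ c, g b = some c ∧ E b = E c + 1) (k : ℕ) (b : α) :
    (fun x : Option α => x.bind g)^[k] (some b) ≠ none ↔ k ≤ E b := by
  induction k generalizing b with
  | zero => simp
  | succ k ih =>
    rw [Function.iterate_succ_apply, Option.bind_some]
    by_cases hb : E b = 0
    · rw [h0 b hb, iterate_bind_none, hb]; simp
    · obtain ⟨c, hc, hE⟩ := h1 b hb
      rw [hc, ih, hE, Nat.add_le_add_iff_right]

theorem sSup_setOf_le (m : ℕ) : sSup {k : ℕ | k ≤ m} = m := by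
  have : {k : ℕ | k ≤ m} = Set.Iic m := rfl
  rw [this, csSup_Iic]

namespace StringLengths

variable {C D : Crystal I} {i : I} {E F : C.Elt → ℕ} {E' F' : D.Elt → ℕ}

theorem eps_eq (h : C.StringLengths i E F) (b : C.Elt) : C.eps i b = E b := by
  unfold eps
  simp_rw [iterate_bind_ne_none_iff (C.e i) E h.e_none
    (fun b hb => let ⟨c, h1, h2, _⟩ := h.e_some b hb; ⟨c, h1, h2⟩)]
  exact sSup_setOf_le _

theorem phi_eq (h : C.StringLengths i E F) (b : C.Elt) : C.phi i b = F b := by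
  unfold phi
  simp_rw [iterate_bind_ne_none_iff (C.f i) F h.f_none
    (fun b hb => let ⟨c, h1, h2, _⟩ := h.f_some b hb; ⟨c, h1, h2⟩)]
  exact sSup_setOf_le _

theorem e_eq_none_iff (h : C.StringLengths i E F) (b : C.Elt) : C.e i b = none ↔ E b = 0 := by
  refine ⟨fun hb => ?_, h.e_none b⟩
  by_contra hE
  obtain ⟨c, hc, _⟩ := h.e_some b hE
  simp [hb] at hc

/-- As long as ε(b') exceeds φ(b), `e` acts on the right factor; once the excess is used up it acts
on the left one. The truncated subtraction is this excess, and the formula for φ is dual. -/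
theorem tensor (h : C.StringLengths i E F) (h' : D.StringLengths i E' F') :
    (C.tensor D).StringLengths i (fun b => E b.1 + (E' b.2 - F b.1))
      (fun b => F' b.2 + (F b.1 - E' b.2)) where
  e_none := by
    rintro ⟨b, b'⟩ hb
    dsimp only at hb
    simp only [Crystal.tensor, h.phi_eq, h'.eps_eq]
    rw [if_pos (by omega), h.e_none b (by omega)]; rfl
  e_some := by
    rintro ⟨b, b'⟩ hb
    dsimp only at hb
    simp only [Crystal.tensor, h.phi_eq, h'.eps_eq]
    split_ifs with hc
    · obtain ⟨c, h1, h2, h3⟩ := h.e_some b (by omega)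
      refine ⟨(c, b'), by rw [h1]; rfl, ?_, ?_⟩ <;> dsimp only <;> omega
    · obtain ⟨c, h1, h2, h3⟩ := h'.e_some b' (by omega)
      refine ⟨(b, c), by rw [h1]; rfl, ?_, ?_⟩ <;> dsimp only <;> omega
  f_none := by
    rintro ⟨b, b'⟩ hb
    dsimp only at hb
    simp only [Crystal.tensor, h.phi_eq, h'.eps_eq]
    rw [if_neg (by omega), h'.f_none b' (by omega)]; rfl
  f_some := by
    rintro ⟨b, b'⟩ hb
    dsimp only at hb
    simp only [Crystal.tensor, h.phi_eq, h'.eps_eq]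
    split_ifs with hc
    · obtain ⟨c, h1, h2, h3⟩ := h.f_some b (by omega)
      refine ⟨(c, b'), by rw [h1]; rfl, ?_, ?_⟩ <;> dsimp only <;> omega
    · obtain ⟨c, h1, h2, h3⟩ := h'.f_some b' (by omega)
      refine ⟨(b, c), by rw [h1]; rfl, ?_, ?_⟩ <;> dsimp only <;> omega

theorem tensor_e_eq_none_iff (h : C.StringLengths i E F) (h' : D.StringLengths i E' F')
    (b : C.Elt) (b' : D.Elt) :
    (C.tensor D).e i (b, b') = none ↔ E b = 0 ∧ E' b' ≤ F b := by
  refine ((h.tensor h').e_eq_none_iff (b, b')).trans ?_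
  dsimp only
  omega

theorem unit (i : I) : (Crystal.unit I).StringLengths i (fun _ => 0) (fun _ => 0) where
  e_none _ _ := rfl
  e_some _ h := absurd rfl h
  f_none _ _ := rfl
  f_some _ h := absurd rfl h

end StringLengths

/-- The functions `ε` and `φ` of a word, computed from those of its letters. -/
def wordLengths {α : Type} (E F : α → ℕ) : List α → ℕ × ℕ
  | [] => (0, 0)
  | a :: w => (E a + ((wordLengths E F w).1 - F a), (wordLengths E F w).2 + (F a - (wordLengths E F w).1))

theorem StringLengths.exists_pow {C : Crystal I} {i : I} {E F : C.Elt → ℕ}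
    (h : C.StringLengths i E F) (w : List C.Elt) :
    ∃ E' F' : (C.pow w.length).Elt → ℕ, (C.pow w.length).StringLengths i E' F' ∧
      E' (C.ofWord w) = (wordLengths E F w).1 ∧ F' (C.ofWord w) = (wordLengths E F w).2 := by
  have hp : ∀ N, ∃ E' F' : (C.pow N).Elt → ℕ, (C.pow N).StringLengths i E' F' := by
    intro N
    induction N with
    | zero => exact ⟨_, _, StringLengths.unit i⟩
    | succ N ih =>
      obtain ⟨E', F', h'⟩ := ih
      exact ⟨_, _, h.tensor h'⟩
  induction w with
  | nil => exact ⟨_, _, StringLengths.unit i, rfl, rfl⟩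
  | cons a w ih =>
    obtain ⟨E', F', h', h1, h2⟩ := ih
    refine ⟨_, _, h.tensor h', ?_, ?_⟩
    · simp only [wordLengths, ← h1]; rfl
    · simp only [wordLengths, ← h1, ← h2]; rfl

/-- `ε` of a word is at most `k` if and only if each of its letters satisfies a bound in terms of
the weight of the letters before it. -/
theorem wordLengths_fst_le_iff {α : Type} (E F : α → ℕ) (w : List α) (k : ℕ) :
    (wordLengths E F w).1 ≤ k ↔ ∀ u a v, w = u ++ a :: v →
      (E a : ℤ) ≤ k + (u.map (fun x => (F x : ℤ) - E x)).sum := by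
  induction w generalizing k with
  | nil => simp [wordLengths]
  | cons a w ih =>
    -- The first letter spends `E a` of the budget `k` and adds `F a` to what the rest may use.
    have key : (wordLengths E F (a :: w)).1 ≤ k ↔
        E a ≤ k ∧ (wordLengths E F w).1 ≤ k - E a + F a := by
      simp only [wordLengths]; omega
    rw [key, ih]
    constructor
    · rintro ⟨h1, h2⟩ u x v huv
      rcases u with _ | ⟨y, u⟩
      · simp only [List.nil_append, List.cons.injEq] at huv
        simpa [← huv.1] using h1
      · simp only [List.cons_append, List.cons.injEq] at huv
        obtain ⟨rfl, rfl⟩ := huv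
        have := h2 u x v rfl
        simp only [List.map_cons, List.sum_cons]
        push_cast [Nat.cast_sub h1] at this
        linarith
    · intro h
      have h1 : E a ≤ k := by simpa using h [] a w rfl
      refine ⟨h1, fun u x v huv => ?_⟩
      have := h (a :: u) x v (by rw [huv]; rfl)
      simp only [List.map_cons, List.sum_cons] at this
      push_cast [Nat.cast_sub h1]
      linarith

end Crystal

/-! ### Strings in the vector representation -/

/-- `ε_i` of a letter. -/
def letterEps (X : ClassicalType) (n i : ℕ) : Letter → ℕ
  | .pos j => if i < n then (if j = i + 1 then 1 else 0) else 0
  | .zero => if i < n then 0 else if X = .B then 1 else 0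
  | .neg j =>
    if i < n then (if j = i then 1 else 0)
    else match X with
      | .B => if j = n then 2 else 0
      | .C => if j = n then 1 else 0
      | .D => if j = n ∨ j = n - 1 then 1 else 0

/-- `φ_i` of a letter. -/
def letterPhi (X : ClassicalType) (n i : ℕ) : Letter → ℕ
  | .neg j => if i < n then (if j = i + 1 then 1 else 0) else 0
  | .zero => if i < n then 0 else if X = .B then 1 else 0
  | .pos j =>
    if i < n then (if j = i then 1 else 0)
    else match X with
      | .B => if j = n then 2 else 0
      | .C => if j = n then 1 else 0
      | .D => if j = n ∨ j = n - 1 then 1 else 0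

theorem vectorE_of_lt (X : ClassicalType) {n i : ℕ} (h : 1 ≤ i ∧ i < n) (a : Letter) :
    vectorE X n i a = match a with
      | .pos j => if j = i + 1 then some (.pos i) else none
      | .zero => none
      | .neg j => if j = i then some (.neg (i + 1)) else none := by
  delta vectorE
  exact (if_pos h).trans (by cases a <;> rfl)

theorem vectorF_of_lt (X : ClassicalType) {n i : ℕ} (h : 1 ≤ i ∧ i < n) (a : Letter) :
    vectorF X n i a = match a with
      | .pos j => if j = i then some (.pos (i + 1)) else none
      | .zero => none
      | .neg j => if j = i + 1 then some (.neg i) else none := by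
  delta vectorF
  exact (if_pos h).trans (by cases a <;> rfl)

theorem vectorE_self (X : ClassicalType) (n : ℕ) (a : Letter) :
    vectorE X n n a = match X, a with
    | .B, .neg j => if j = n then some .zero else none
    | .B, .zero => some (.pos n)
    | .C, .neg j => if j = n then some (.pos n) else none
    | .D, .neg j =>
        if j = n then some (.pos (n - 1)) else if j = n - 1 then some (.pos n) else none
    | _, _ => none := by
  delta vectorE
  exact (if_neg (by omega)).trans ((if_pos rfl).trans (by
    rcases X with _ | _ | _ <;> rcases a with _ | _ | _ <;> rfl))

theorem vectorF_self (X : ClassicalType) (n : ℕ) (a : Letter) :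
    vectorF X n n a = match X, a with
    | .B, .pos j => if j = n then some .zero else none
    | .B, .zero => some (.neg n)
    | .C, .pos j => if j = n then some (.neg n) else none
    | .D, .pos j =>
        if j = n - 1 then some (.neg n) else if j = n then some (.neg (n - 1)) else none
    | _, _ => none := by
  delta vectorF
  exact (if_neg (by omega)).trans ((if_pos rfl).trans (by
    rcases X with _ | _ | _ <;> rcases a with _ | _ | _ <;> rfl))

theorem vector_stringLengths (X : ClassicalType) {n i : ℕ} (hi : 1 ≤ i) (hin : i ≤ n) :
    (vector X n).StringLengths i (letterEps X n i) (letterPhi X n i) := by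
  rcases Nat.lt_or_eq_of_le hin with hn | rfl
  · have e := vectorE_of_lt X ⟨hi, hn⟩
    have f := vectorF_of_lt X ⟨hi, hn⟩
    constructor <;> rintro (j | _ | j) hb <;> simp only [letterEps, letterPhi, if_pos hn] at hb <;>
      simp [vector, e, f, letterEps, letterPhi, hn] <;> simp_all
  · constructor <;> rintro (j | _ | j) hb <;> cases X <;>
      simp [letterEps, letterPhi] at hb <;>
      simp [vector, vectorE_self, vectorF_self, letterEps, letterPhi] <;>
      first
      | simp [hb]
      | (by_cases hj : j = i
         · subst hj; simp [show j ≠ j - 1 by omega]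
         · simp [hb hj, show i - 1 ≠ i by omega])

end KRCrystal

/-! ### Highest elements in terms of words; the first tensor factor -/

namespace KRCrystal

theorem isClassicallyHighest_iff (X : ClassicalType) (n : ℕ) (b b' : Tableau) :
    IsClassicallyHighest X n b b' ↔ ∀ i, 1 ≤ i → i ≤ n →
      (Crystal.wordLengths (letterEps X n i) (letterPhi X n i) b.word).1 = 0 ∧
      (Crystal.wordLengths (letterEps X n i) (letterPhi X n i) b'.word).1 ≤
        (Crystal.wordLengths (letterEps X n i) (letterPhi X n i) b.word).2 := by
  unfold IsClassicallyHighest Crystal.IsHighest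
  refine forall_congr' fun i => ?_
  rw [Set.mem_Icc, and_imp]
  refine forall_congr' fun hi => forall_congr' fun hin => ?_
  have hv := vector_stringLengths X hi hin
  obtain ⟨E, F, h, hE, hF⟩ := Crystal.StringLengths.exists_pow hv b.word
  obtain ⟨E', F', h', hE', hF'⟩ := Crystal.StringLengths.exists_pow hv b'.word
  refine (h.tensor_e_eq_none_iff h' (b.read X n) (b'.read X n)).trans ?_
  change E ((vector X n).ofWord b.word) = 0 ∧ E' ((vector X n).ofWord b'.word) ≤
    F ((vector X n).ofWord b.word) ↔ _
  rw [hE, hF, hE']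
  rfl

/-- The coefficient of `ϵ_x` in the weight of a word. -/
def coeff (x : ℕ) (w : List Letter) : ℤ := (w.count (.pos x) : ℤ) - w.count (.neg x)

@[simp] theorem coeff_nil (x : ℕ) : coeff x [] = 0 := by simp [coeff]

@[simp] theorem coeff_append (x : ℕ) (u v : List Letter) :
    coeff x (u ++ v) = coeff x u + coeff x v := by
  simp only [coeff, List.count_append]; push_cast; ring

theorem coeff_cons (x : ℕ) (a : Letter) (v : List Letter) :
    coeff x (a :: v) = coeff x [a] + coeff x v := by
  rw [← List.singleton_append, coeff_append]

@[simp] theorem coeff_pos (x y : ℕ) : coeff x [.pos y] = if y = x then 1 else 0 := by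
  simp [coeff, List.count_singleton]

@[simp] theorem coeff_neg (x y : ℕ) : coeff x [.neg y] = if y = x then -1 else 0 := by
  simp only [coeff, List.count_singleton]; split_ifs <;> simp_all

@[simp] theorem coeff_zero (x : ℕ) : coeff x [.zero] = 0 := by
  simp [coeff]

/-- φ_i − ε_i is the pairing of the weight with the i-th simple coroot, here ϵ_i − ϵ_{i+1}. -/
theorem sum_weight_of_lt (X : ClassicalType) {n i : ℕ} (h : i < n) (u : List Letter) :
    (u.map (fun a => (letterPhi X n i a : ℤ) - letterEps X n i a)).sum =
      coeff i u - coeff (i + 1) u := by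
  induction u with
  | nil => simp
  | cons a u ih =>
    rw [List.map_cons, List.sum_cons, ih, coeff_cons i, coeff_cons (i + 1)]
    rcases a with j | _ | j <;> simp [letterPhi, letterEps, h] <;> split_ifs <;> simp <;> omega

/-- The last simple coroot is 2ϵ_n, ϵ_n, ϵ_{n-1} + ϵ_n in types B, C, D. -/
theorem sum_weight_self (X : ClassicalType) {n : ℕ} (hn : 1 ≤ n) (u : List Letter) :
    (u.map (fun a => (letterPhi X n n a : ℤ) - letterEps X n n a)).sum =
      match X with
      | .B => 2 * coeff n u
      | .C => coeff n u
      | .D => coeff (n - 1) u + coeff n u := by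
  induction u with
  | nil => cases X <;> simp
  | cons a u ih =>
    rw [List.map_cons, List.sum_cons, ih, coeff_cons n, coeff_cons (n - 1)]
    cases X <;> rcases a with j | _ | j <;> simp [letterPhi, letterEps] <;> split_ifs <;>
      (try simp) <;> omega

/-- `ε_i ≤ k` for a word, when no letter has both `ε_i` and `φ_i` nonzero. -/
theorem wordLengths_fst_le_iff_prefix {α : Type} (E F : α → ℕ) (w : List α) (k : ℕ)
    (hE : ∀ a ∈ w, E a = 0 ∨ F a = 0) :
    (Crystal.wordLengths E F w).1 ≤ k ↔ ∀ u, u <+: w →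
      -(k : ℤ) ≤ (u.map (fun x => (F x : ℤ) - E x)).sum := by
  rw [Crystal.wordLengths_fst_le_iff]
  constructor
  · intro h u hu
    rcases List.eq_nil_or_concat u with rfl | ⟨u, a, rfl⟩
    · simp
    · rw [List.concat_eq_append] at hu ⊢
      obtain ⟨v, hv⟩ := hu
      have := h u a v (by rw [← hv]; simp)
      simp only [List.map_append, List.map_cons, List.map_nil, List.sum_append, List.sum_cons,
        List.sum_nil]
      have : (0 : ℤ) ≤ F a := by positivity
      linarith
  · rintro h u a v rfl
    have h1 := h u ⟨_, rfl⟩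
    have h2 := h (u ++ [a]) ⟨v, by simp⟩
    simp only [List.map_append, List.map_cons, List.map_nil, List.sum_append, List.sum_cons,
        List.sum_nil] at h2
    -- If `E a = 0`, the bound for the prefix before `a` suffices; if `F a = 0`, use the prefix that
    -- includes `a`.
    rcases hE a (by simp) with h0 | h0 <;> zify at h0 <;> linarith

theorem wordLengths_fst_le_iff_coeff (X : ClassicalType) {n i : ℕ} (h : i < n) (w : List Letter)
    (k : ℕ) : (Crystal.wordLengths (letterEps X n i) (letterPhi X n i) w).1 ≤ k ↔
      ∀ u, u <+: w → -(k : ℤ) ≤ coeff i u - coeff (i + 1) u := by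
  rw [wordLengths_fst_le_iff_prefix]
  · simp_rw [sum_weight_of_lt X h]
  · rintro (j | _ | j) - <;> simp [letterEps, letterPhi, h] <;> omega

theorem word_cons (C : List Letter) (T : Tableau) :
    Tableau.word (C :: T) = Tableau.word T ++ C := by
  simp [Tableau.word]

theorem word_oneRow (l : ℕ) : (oneRow l).word = List.replicate l (.pos 1) := by
  simp [Tableau.word, oneRow]

/-- In type D the letter 1 must differ from n − 1, since φ_n(n − 1) = 1; this is why 3 ≤ n is needed
there. -/
theorem wordLengths_replicate_one (X : ClassicalType) {n i : ℕ} (hn : 2 ≤ n) (hi : 1 ≤ i)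
    (hin : i ≤ n) (hD : X = .D → 3 ≤ n) (l : ℕ) :
    Crystal.wordLengths (letterEps X n i) (letterPhi X n i) (List.replicate l (.pos 1)) =
      (0, if i = 1 then l else 0) := by
  have hE : letterEps X n i (.pos 1) = 0 := by
    simp only [letterEps]; split_ifs <;> first | rfl | omega
  have hF : letterPhi X n i (.pos 1) = if i = 1 then 1 else 0 := by
    rcases Nat.lt_or_eq_of_le hin with h | rfl
    · simp only [letterPhi, if_pos h]; split_ifs <;> omega
    · rw [if_neg (show i ≠ 1 by omega)]
      cases X <;> simp only [letterPhi, lt_irrefl, if_false, reduceCtorEq, forall_const,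
        IsEmpty.forall_iff] at hD ⊢ <;> rw [if_neg (by omega)]
  induction l with
  | zero => simp [Crystal.wordLengths]
  | succ l ih =>
    rw [List.replicate_succ, Crystal.wordLengths, ih, hE, hF]
    split_ifs <;> simp

theorem eq_pos_one_of_letterEps (X : ClassicalType) {n : ℕ} {a : Letter} (hn : 2 ≤ n)
    (ha : a.Valid X n) (h : ∀ i, 1 ≤ i → i ≤ n → letterEps X n i a = 0) : a = .pos 1 := by
  rcases a with j | _ | j
  · obtain ⟨h1, h2⟩ := ha
    by_contra hj
    have hj : j ≠ 1 := fun h => hj (by rw [h])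
    have := h (j - 1) (by omega) (by omega)
    simp [letterEps, show j - 1 < n by omega] at this
    omega
  · have ha : X = .B := ha
    have := h n (by omega) le_rfl
    simp [letterEps, ha] at this
  · obtain ⟨h1, h2⟩ := ha
    have := h j h1 h2
    rcases Nat.lt_or_eq_of_le h2 with h3 | rfl
    · simp [letterEps, h3] at this
    · cases X <;> simp [letterEps] at this

/-- The highest element of `B^{1,l}`. -/
theorem eq_oneRow_of_highest (X : ClassicalType) {n l : ℕ} (hn : 2 ≤ n) {b : Tableau}
    (hb : b ∈ KR X n 1 l)
    (h : ∀ i, 1 ≤ i → i ≤ n →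
      (Crystal.wordLengths (letterEps X n i) (letterPhi X n i) b.word).1 = 0) :
    b = oneRow l := by
  obtain ⟨hl, hlen, hcol, hchain⟩ := hb
  have hcols : ∀ C ∈ b, ∃ a : Letter, C = [a] ∧ a.Valid X n := by
    intro C hC
    obtain ⟨h1, h2⟩ := hlen C hC
    obtain ⟨a, rfl⟩ := List.length_eq_one_iff.mp (show C.length = 1 by
      unfold Nat.ModEq at h2; omega)
    exact ⟨a, rfl, (hcol _ hC).1 a (by simp)⟩
  suffices hall : ∀ C ∈ b, C = [.pos 1] from
    List.eq_replicate_iff.mpr ⟨hl, hall⟩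
  clear hl hlen hcol
  induction b with
  | nil => simp
  | cons C T ih =>
    -- The columns to the right are read first, so their word is a prefix and is highest as well.
    -- Afterwards the row condition next to an entry 1, the least letter, settles the remaining
    -- column.
    have hT : ∀ D ∈ T, D = [Letter.pos 1] := by
      refine ih ?_ (by exact (List.isChain_cons.mp hchain).2) fun D hD => hcols D (by simp [hD])
      intro i hi hin
      have := h i hi hin
      rw [← Nat.le_zero, Crystal.wordLengths_fst_le_iff, word_cons] at this
      rw [← Nat.le_zero, Crystal.wordLengths_fst_le_iff]
      rintro u a v huv
      exact this u a (v ++ C) (by rw [huv]; simp)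
    obtain ⟨a, rfl, ha⟩ := hcols C (by simp)
    suffices a = .pos 1 by
      intro D hD
      rcases List.mem_cons.mp hD with rfl | hD
      · rw [this]
      · exact hT D hD
    rcases T with _ | ⟨D, T⟩
    · refine eq_pos_one_of_letterEps X hn ha fun i hi hin => ?_
      have := h i hi hin
      simpa [Crystal.wordLengths, Tableau.word] using this
    · have hD := hT D (by simp)
      subst hD
      have hp := (List.isChain_cons_cons.mp hchain).1
      have := hp.2.1 (a, .pos 1) (by simp)
      rcases this with h1 | h1
      · rcases a with j | _ | j <;> simp only [Letter.LT] at h1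
        obtain ⟨h2, h3⟩ := ha
        omega
      · exact h1.1

end KRCrystal

/-! ### Encoding of columns, and the weights of prefixes -/

namespace KRCrystal

/-- The column `1 2 ⋯ h (h+2) ⋯ (m+1)` of height `m` (which is `1 2 ⋯ m` if `m ≤ h`). -/
def gapString (h m : ℕ) : List Letter :=
  (List.range m).map fun j => .pos (if j < h then j + 1 else j + 2)

@[simp] theorem length_gapString (h m : ℕ) : (gapString h m).length = m := by simp [gapString]

theorem gapString_succ (h m : ℕ) :
    gapString h (m + 1) = gapString h m ++ [.pos (if m < h then m + 1 else m + 2)] := by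
  simp [gapString, List.range_succ]

theorem getElem?_gapString {h m j : ℕ} (hj : j < m) :
    (gapString h m)[j]? = some (.pos (if j < h then j + 1 else j + 2)) := by
  simp [gapString, hj]

theorem gapString_congr {h h' m : ℕ} (hh : m ≤ h) (hh' : m ≤ h') :
    gapString h m = gapString h' m := by
  refine List.map_congr_left fun j hj => ?_
  rw [List.mem_range] at hj
  rw [if_pos (by omega), if_pos (by omega)]

theorem exists_of_mem_gapString {h m : ℕ} {a : Letter} (ha : a ∈ gapString h m) :
    ∃ y, a = .pos y ∧ 1 ≤ y ∧ y ≤ m + 1 := by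
  simp only [gapString, List.mem_map, List.mem_range] at ha
  obtain ⟨j, hj, rfl⟩ := ha
  exact ⟨_, rfl, by split_ifs <;> omega, by split_ifs <;> omega⟩

/-- The omitted letter is h + 1; the shift to x + 1 puts the omission at x = h. -/
theorem coeff_gapString (x h m : ℕ) :
    coeff (x + 1) (gapString h m) = if (x < h ∧ x < m) ∨ (h < x ∧ x ≤ m) then 1 else 0 := by
  induction m with
  | zero => simp [gapString]; omega
  | succ m ih =>
    rw [gapString_succ, coeff_append, ih, coeff_pos]
    split_ifs <;> first | rfl | omega

theorem eq_gapString_of_prefix {h m : ℕ} {u : List Letter} (hu : u <+: gapString h m) :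
    ∃ p ≤ m, u = gapString h p := by
  induction m with
  | zero => exact ⟨0, le_rfl, by simpa [gapString] using hu⟩
  | succ m ih =>
    rw [gapString_succ, List.prefix_concat_iff] at hu
    rcases hu with rfl | hu
    · exact ⟨m + 1, le_rfl, (gapString_succ h m).symm⟩
    · obtain ⟨p, hp, rfl⟩ := ih hu
      exact ⟨p, by omega, rfl⟩

theorem prefix_append_iff {α : Type} {u a b : List α} :
    u <+: a ++ b ↔ u <+: a ∨ ∃ v, u = a ++ v ∧ v <+: b := by
  constructor
  · rintro ⟨t, ht⟩
    rcases List.append_eq_append_iff.mp ht with ⟨c, h1, -⟩ | ⟨c, h1, h2⟩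
    · exact .inl ⟨c, h1.symm⟩
    · exact .inr ⟨c, h1, ⟨t, h2.symm⟩⟩
  · rintro (h | ⟨v, rfl, h⟩)
    · exact h.trans (List.prefix_append _ _)
    · exact (List.prefix_append_right_inj _).mpr h

/-- A column `1 2 ⋯ h (h+2) ⋯ (m+1)`, `h = gap`, `m = mid`, with the letter `(g+1)‾` on top of it
if `bar = some g`. -/
structure ColData where
  mid : ℕ
  gap : ℕ
  bar : Option ℕ

namespace ColData

/-- The entries of the column. -/
def col (d : ColData) : List Letter :=
  gapString d.gap d.mid ++ d.bar.toList.map fun g => .neg (g + 1)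

/-- The heights by which the parts of a column are altered, from top to bottom. -/
def colHeights (d : ColData) : List ℕ := d.bar.toList ++ [d.gap]

/-- The heights of the alterations of all columns, from left to right. -/
def heights (l : List ColData) : List ℕ := l.flatMap colHeights

/-- The tableau with the given columns. -/
def tab (l : List ColData) : Tableau := l.map col

@[simp] theorem heights_nil : heights [] = [] := rfl

theorem heights_cons (d : ColData) (l : List ColData) :
    heights (d :: l) = d.bar.toList ++ d.gap :: heights l := by
  simp [heights, colHeights]

theorem word_tab_cons (d : ColData) (l : List ColData) :
    (tab (d :: l)).word = (tab l).word ++ d.col := word_cons _ _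

/-- The number of columns with a given value of `mid`. -/
def numMid (h : ℕ) (l : List ColData) : ℕ := l.countP fun d => d.mid = h

theorem numMid_cons (h : ℕ) (d : ColData) (l : List ColData) :
    numMid h (d :: l) = numMid h l + if d.mid = h then 1 else 0 := by
  simp [numMid, List.countP_cons]

theorem coeff_bar (x : ℕ) (b : Option ℕ) :
    coeff (x + 1) (b.toList.map fun g => Letter.neg (g + 1)) = -(b.toList.count x : ℤ) := by
  rcases b with _ | g
  · simp
  · simp [List.count_singleton]
    split_ifs <;> rfl

/-- A column with `x ≤ mid` contains x + 1 unless `x = gap`, and a bar at `x` contributes −1.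
Because `gap ≤ mid`, each occurrence of `x` as a gap cancels a column that was counted. -/
theorem coeff_word_tab (x : ℕ) (l : List ColData) (hl : ∀ d ∈ l, d.gap ≤ d.mid) :
    coeff (x + 1) (tab l).word = (l.countP fun d => x ≤ d.mid : ℤ) - (heights l).count x := by
  induction l with
  | nil => simp [tab, Tableau.word]
  | cons d l ih =>
    have hd := hl d (by simp)
    rw [word_tab_cons, coeff_append, ih fun d hd => hl d (by simp [hd]), col, coeff_append,
      coeff_bar, coeff_gapString, heights_cons, List.count_append, List.count_cons,
      List.countP_cons]
    simp only [decide_eq_true_eq, beq_iff_eq]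
    push_cast
    split_ifs <;> omega

theorem countP_le_mid (x : ℕ) (l : List ColData) :
    (l.countP fun d => x ≤ d.mid) = (l.countP fun d => x + 1 ≤ d.mid) + numMid x l := by
  induction l with
  | nil => rfl
  | cons d l ih =>
    rw [numMid_cons, List.countP_cons, List.countP_cons, ih]
    simp only [decide_eq_true_eq]
    split_ifs <;> omega

theorem coeff_sub_coeff_word_tab (x : ℕ) (l : List ColData) (hl : ∀ d ∈ l, d.gap ≤ d.mid) :
    coeff (x + 1) (tab l).word - coeff (x + 2) (tab l).word =
      numMid x l - (heights l).count x + (heights l).count (x + 1) := by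
  rw [coeff_word_tab x l hl, coeff_word_tab (x + 1) l hl, countP_le_mid]
  push_cast
  ring

/-- In the columns from any column on, the height `h` does not occur more than `k` times more often
in `heights` than as a value of `mid`. -/
def Bounded (h k : ℕ) : List ColData → Prop
  | [] => True
  | d :: l => (heights (d :: l)).count h ≤ numMid h (d :: l) + k ∧ Bounded h k l

theorem Bounded.count_le {h k : ℕ} {l : List ColData} (hb : Bounded h k l) :
    (heights l).count h ≤ numMid h l + k := by
  cases l with
  | nil => simp
  | cons d l => exact hb.1

/-- Within a column the difference falls below its value at the start of the column only through a
letter h + 2 not preceded by h + 1, or through the bar (h+1)‾. Both are occurrences of `h` in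
`heights`, which the bound including the current column pays for. -/
theorem Bounded.neg_le_coeff {h k : ℕ} {l : List ColData} (hb : Bounded h k l)
    (hl : ∀ d ∈ l, d.gap ≤ d.mid) {u : List Letter} (hu : u <+: (tab l).word) :
    -(k : ℤ) ≤ coeff (h + 1) u - coeff (h + 2) u := by
  induction l with
  | nil =>
    have : u = [] := by simpa [tab, Tableau.word] using hu
    simp [this]
  | cons d l ih =>
    have hl' : ∀ d ∈ l, d.gap ≤ d.mid := fun d hd => hl d (by simp [hd])
    have hfull := coeff_sub_coeff_word_tab h (d :: l) hl
    have htail := coeff_sub_coeff_word_tab h l hl'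
    have hc := hb.1
    have hc' := hb.2.count_le
    have hw := word_tab_cons d l
    rw [hw, prefix_append_iff] at hu
    rcases hu with hu | ⟨v, rfl, hv⟩
    · exact ih hb.2 hl' hu
    · rw [col, prefix_append_iff] at hv
      rcases hv with hv | ⟨v, rfl, hv⟩
      · obtain ⟨p, hp, rfl⟩ := eq_gapString_of_prefix hv
        rw [heights_cons, List.count_append, List.count_cons, numMid_cons] at hc
        simp only [beq_iff_eq] at hc
        rw [coeff_append, coeff_append, coeff_gapString, coeff_gapString]
        split_ifs at hc ⊢ <;> omega
      · have hv' : v = [] ∨ v = d.bar.toList.map fun g => .neg (g + 1) := by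
          rcases hd : d.bar with _ | g
          · left; simpa [hd] using hv
          · rw [hd] at hv
            rcases v with _ | ⟨a, v⟩
            · simp
            · right
              simp at hv
              simp [hv.1, hv.2]
        rcases hv' with rfl | rfl
        · rw [heights_cons, List.count_append, List.count_cons, numMid_cons] at hc
          simp only [beq_iff_eq] at hc
          rw [List.append_nil, coeff_append, coeff_append, coeff_gapString, coeff_gapString]
          split_ifs at hc ⊢ <;> omega
        · rw [← col, ← hw]
          omega

/-- The heights are met in increasing order when the word is read. At the last occurrence of `h` no
h + 1 has been met, so the term counting h + 1 vanishes and the prefix condition is the asserted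
bound. -/
theorem count_le_of_neg_le_coeff {h k : ℕ} {l : List ColData}
    (hs : (heights l).Pairwise (· ≥ ·)) (hl : ∀ d ∈ l, d.gap ≤ d.mid)
    (hu : ∀ u, u <+: (tab l).word → -(k : ℤ) ≤ coeff (h + 1) u - coeff (h + 2) u) :
    (heights l).count h ≤ numMid h l + k := by
  induction l with
  | nil => simp
  | cons d l ih =>
    have hl' : ∀ d ∈ l, d.gap ≤ d.mid := fun d hd => hl d (by simp [hd])
    have hw := word_tab_cons d l
    have hfull := coeff_sub_coeff_word_tab h (d :: l) hl
    have hs0 := hs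
    rw [heights_cons, List.pairwise_append, List.pairwise_cons] at hs
    obtain ⟨-, ⟨hs1, hs2⟩, hs3⟩ := hs
    have hle := ih hs2 hl' fun u h => hu u (by rw [hw]; exact h.trans (List.prefix_append _ _))
    by_cases hgap : d.gap = h
    · have h1 := coeff_sub_coeff_word_tab h ({ d with bar := none } :: l) (by
        intro e he
        rcases List.mem_cons.mp he with rfl | he
        · exact hl d (by simp)
        · exact hl' e he)
      have h0 : (heights l).count (h + 1) = 0 := by
        rw [List.count_eq_zero]
        intro hm
        have := hs1 _ hm
        omega
      by_cases hbar : d.bar = some h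
      · have := hu _ (List.prefix_refl _)
        have h2 : (heights (d :: l)).count (h + 1) = 0 := by
          rw [heights_cons, List.count_append, List.count_cons, h0, hbar, hgap]
          simp
        omega
      · have := hu (tab ({ d with bar := none } :: l)).word (by
          rw [hw, word_tab_cons, col, col]
          simp)
        have h2 : d.bar.toList.count h = 0 := by
          rw [List.count_eq_zero]
          simpa [eq_comm] using hbar
        rw [h1, heights_cons, List.count_append, List.count_append,
          List.count_cons, List.count_cons, numMid_cons] at this
        rw [heights_cons, List.count_append, List.count_cons, numMid_cons]
        simp only [hgap, h0, h2, beq_iff_eq, Option.toList_none, List.count_nil, if_true,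
          show h ≠ h + 1 by omega, if_false] at this ⊢
        push_cast at this
        split_ifs at this ⊢ <;> omega
    · by_cases hbar : d.bar = some h
      · have := hu _ (List.prefix_refl _)
        have h2 : (heights (d :: l)).count (h + 1) = 0 := by
          rw [List.count_eq_zero, heights_cons, hbar]
          intro hm
          rcases List.mem_append.mp hm with hm | hm
          · simp at hm
          · have := hs3 h (by simp [hbar]) _ hm
            omega
        omega
      · have h2 : d.bar.toList.count h = 0 := by
          rw [List.count_eq_zero]
          simpa [eq_comm] using hbar
        rw [heights_cons, List.count_append, List.count_cons, numMid_cons, h2]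
        simp only [beq_iff_eq, hgap, if_false]
        omega

end ColData

end KRCrystal

namespace KRCrystal

open PMDiagram

theorem string_succ {a b : ℕ} (h : a ≤ b + 1) :
    PMDiagram.string a (b + 1) = PMDiagram.string a b ++ [.pos (b + 1)] := by
  unfold PMDiagram.string
  rw [show b + 1 + 1 - a = b + 1 - a + 1 by omega, List.range'_concat, List.map_append]
  simp
  omega

theorem string_of_lt {a b : ℕ} (h : b < a) : PMDiagram.string a b = [] := by
  simp [PMDiagram.string, show b + 1 - a = 0 by omega]

theorem string_append_string {h m : ℕ} (hm : h ≤ m) :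
    PMDiagram.string 1 h ++ PMDiagram.string (h + 2) (m + 1) = gapString h m := by
  induction m, hm using Nat.le_induction with
  | base =>
    rw [string_of_lt (by omega : h + 1 < h + 2), List.append_nil]
    induction h with
    | zero => rfl
    | succ h ih =>
      rw [string_succ (by omega), ih, gapString_succ, if_pos (by omega),
        gapString_congr le_rfl (Nat.le_succ h)]
  | succ m hm ih =>
    rw [string_succ (by omega), ← List.append_assoc, ih, gapString_succ, if_neg (by omega)]

theorem string_two (m : ℕ) : PMDiagram.string 2 (m + 1) = gapString 0 m := by
  rw [← string_append_string (Nat.zero_le m)]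
  rfl

theorem string_one (m : ℕ) : PMDiagram.string 1 m = gapString m m := by
  rw [← string_append_string le_rfl, string_of_lt (by omega : m + 1 < m + 2), List.append_nil]

/-- The heights of the `+`'s, except those at height `n`, in columns given by the heights of their
outer, middle and inner parts. -/
def plusList (n : ℕ) (cols : List (ℕ × ℕ × ℕ)) : List ℕ :=
  (cols.filter fun c => c.2.2 < c.2.1 ∧ c.2.1 ≠ n).map fun c => c.2.1

theorem plusList_cons (n : ℕ) (c : ℕ × ℕ × ℕ) (cols : List (ℕ × ℕ × ℕ)) :
    plusList n (c :: cols) =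
      if c.2.2 < c.2.1 ∧ c.2.1 ≠ n then c.2.1 :: plusList n cols else plusList n cols := by
  unfold plusList
  rw [List.filter_cons]
  split_ifs with h1 h2 h2 <;> simp_all

theorem mem_plusList {n g : ℕ} {cols : List (ℕ × ℕ × ℕ)} (hg : g ∈ plusList n cols) :
    1 ≤ g ∧ g ≠ n ∧ ∃ c ∈ cols, c.2.1 = g := by
  simp only [plusList, List.mem_map, List.mem_filter, decide_eq_true_eq] at hg
  obtain ⟨c, ⟨hc, h1, h2⟩, rfl⟩ := hg
  exact ⟨by omega, h2, c, hc, rfl⟩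

theorem count_plusList_le (n h : ℕ) (cols : List (ℕ × ℕ × ℕ)) :
    (if h = n then cols.countP (fun c => c.2.1 = n) else 0) + (plusList n cols).count h ≤
      (cols.map fun c => c.2.1).count h := by
  induction cols with
  | nil => simp [plusList]
  | cons c cols ih =>
    rw [plusList_cons, List.map_cons, List.count_cons, List.countP_cons]
    simp only [beq_iff_eq, decide_eq_true_eq]
    by_cases hc : c.2.2 < c.2.1 ∧ c.2.1 ≠ n
    · rw [if_pos hc, List.count_cons]
      simp only [beq_iff_eq]
      split_ifs at ih ⊢ <;> omega
    · rw [if_neg hc]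
      split_ifs at ih ⊢ <;> omega

theorem ColData.numMid_eq_count (h : ℕ) (l : List ColData) :
    numMid h l = (l.map mid).count h := by
  induction l with
  | nil => rfl
  | cons d l ih => rw [numMid_cons, ih, List.map_cons, List.count_cons]; simp

open ColData

theorem suffix_of_cons_suffix_plusList {n g : ℕ} {hs : List ℕ} {c : ℕ × ℕ × ℕ}
    {cols : List (ℕ × ℕ × ℕ)} (h : g :: hs <:+ plusList n (c :: cols)) :
    hs <:+ plusList n cols := by
  rw [plusList_cons] at h
  split_ifs at h
  · rcases List.suffix_cons_iff.mp h with h | h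
    · rw [(List.cons.inj h).2]
    · exact (List.suffix_cons _ _).trans h
  · exact (List.suffix_cons _ _).trans h

/-- The columns produced by `PhiAux`. -/
theorem exists_colData_phiAux (n : ℕ) (cols : List (ℕ × ℕ × ℕ)) (hs : List ℕ)
    (hc : ∀ c ∈ cols, c.2.1 ≤ c.1 ∧ c.1 ≤ c.2.1 + 1 ∧ c.1 ≤ n ∧ (c.2.1 = n → c.2.2 < c.2.1))
    (hm : cols.Pairwise fun c c' => c'.2.1 ≤ c.2.1) (hsuf : hs <:+ plusList n cols) :
    ∃ (l : List ColData) (z : ℕ), PhiAux n cols hs = tab l ∧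
      l.map ColData.mid = cols.map (fun c => c.2.1) ∧ (∀ d ∈ l, d.gap ≤ d.mid) ∧
      heights l = List.replicate (cols.countP fun c => c.2.1 = n) n ++ (hs ++ List.replicate z 0) ∧
      (heights l).length = cols.length + (cols.countP fun c => c.2.1 < c.1) ∧
      ∀ h, 1 ≤ h → Bounded h 0 l := by
  induction cols generalizing hs with
  | nil =>
    have : hs = [] := by simpa [plusList] using hsuf
    exact ⟨[], 0, by simp [PhiAux, tab], rfl, by simp, by simp [this], rfl, fun _ _ => trivial⟩
  | cons c cols ih =>
    obtain ⟨o, m, i⟩ := c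
    obtain ⟨h1, h2, h3, h4⟩ := hc (o, m, i) (by simp)
    have hc' := fun c hcc => hc c (List.mem_cons_of_mem _ hcc)
    rw [List.pairwise_cons] at hm
    obtain ⟨hm1, hm2⟩ := hm
    dsimp only at h1 h2 h3 h4 hm1
    have hpos : ∀ g ∈ hs, 1 ≤ g ∧ g ≤ m := by
      intro g hg
      obtain ⟨h5, -, c, h6, rfl⟩ := mem_plusList (hsuf.subset hg)
      rcases List.mem_cons.mp h6 with rfl | h6
      · exact ⟨h5, le_rfl⟩
      · exact ⟨h5, hm1 c h6⟩
    -- it suffices to find the first column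
    suffices hmain : ∃ (d : ColData) (hs' : List ℕ),
        PhiAux n ((o, m, i) :: cols) hs = d.col :: PhiAux n cols hs' ∧ d.mid = m ∧
        d.gap ≤ m ∧ hs' <:+ plusList n cols ∧
        d.bar.toList.length = (if m < o then 1 else 0) ∧
        (m = n → d.bar = none ∧ d.gap = n ∧ hs' = hs) ∧
        (m ≠ n → ∃ z, hs ++ List.replicate z 0 = d.bar.toList ++ d.gap :: hs' ∧
          (z ≠ 0 → hs' = [])) by
      obtain ⟨d, hs', e1, e2, e3, e4, e5, e6, e7⟩ := hmain
      obtain ⟨l, z, i1, i2, i3, i4, i5, i6⟩ := ih hs' hc' hm2 e4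
      have hmid : (d :: l).map ColData.mid =
          ((o, m, i) :: cols).map (fun c : ℕ × ℕ × ℕ => c.2.1) := by
        rw [List.map_cons, List.map_cons, i2, e2]
      have hheights : ∃ z', heights (d :: l) =
          List.replicate (((o, m, i) :: cols).countP fun c => c.2.1 = n) n ++
            (hs ++ List.replicate z' 0) := by
        rw [heights_cons, i4]
        by_cases hmn : m = n
        · obtain ⟨e8, e9, rfl⟩ := e6 hmn
          refine ⟨z, ?_⟩
          rw [e8, e9, List.countP_cons]
          simp [hmn, List.replicate_succ]
        · obtain ⟨z', e7, e8⟩ := e7 hmn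
          have h0 : (cols.countP fun c => c.2.1 = n) = 0 := by
            rw [List.countP_eq_zero]
            intro c hcc
            have := hm1 c hcc
            simp only [decide_eq_true_eq]
            omega
          rw [List.countP_cons, h0]
          simp only [hmn, decide_false, List.replicate_zero, List.nil_append, Bool.false_eq_true,
            if_false, Nat.add_zero]
          rcases Nat.eq_zero_or_pos z' with rfl | hz
          · refine ⟨z, ?_⟩
            rw [List.replicate_zero, List.append_nil] at e7
            rw [e7]; simp
          · have := e8 (by omega)
            subst this
            refine ⟨z' + z, ?_⟩
            rw [List.replicate_add, ← List.append_assoc hs, e7]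
            simp
      obtain ⟨z', hheights⟩ := hheights
      refine ⟨d :: l, z', ?_, hmid, ?_, hheights, ?_, ?_⟩
      · rw [e1, i1]; rfl
      · intro e he
        rcases List.mem_cons.mp he with rfl | he
        · omega
        · exact i3 e he
      · rw [heights_cons, List.length_append, List.length_cons, i5, e5, List.length_cons,
          List.countP_cons]
        simp only [decide_eq_true_eq]
        omega
      · refine fun h hh => ⟨?_, i6 h hh⟩
        rw [numMid_eq_count, hmid, hheights, List.count_append, List.count_append,
          List.count_replicate, List.count_replicate]
        have := count_plusList_le n h ((o, m, i) :: cols)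
        have hsub := hsuf.sublist.count_le h
        simp only [beq_iff_eq]
        rw [if_neg (show ¬ 0 = h by omega)]
        split_ifs at this ⊢ <;> omega
    by_cases hfix : m = n ∧ i < m
    · obtain ⟨rfl, him⟩ := hfix
      refine ⟨⟨m, m, none⟩, hs, ?_, rfl, le_rfl, ?_, ?_, fun _ => ⟨rfl, rfl, rfl⟩,
        fun h => absurd rfl h⟩
      · rw [PhiAux, if_pos ⟨rfl, him⟩]
        simp [col, string_one]
      · rwa [plusList_cons, if_neg (by simp)] at hsuf
      · rw [if_neg (by omega)]; rfl
    · have hmn : m ≠ n := fun h => hfix ⟨h, h4 h⟩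
      by_cases hmo : m < o
      · obtain rfl : o = m + 1 := by omega
        rcases hs with _ | ⟨g, _ | ⟨g', hs⟩⟩
        · refine ⟨⟨m, 0, some 0⟩, [], ?_, rfl, Nat.zero_le _, List.nil_suffix, ?_,
            fun h => absurd h hmn, fun _ => ⟨2, rfl, fun _ => rfl⟩⟩
          · rw [PhiAux, if_neg hfix, if_pos hmo]
            simp [alterBar, alterString, col, string_two]
          · rw [if_pos hmo]; rfl
        · refine ⟨⟨m, 0, some g⟩, [], ?_, rfl, Nat.zero_le _, List.nil_suffix, ?_,
            fun h => absurd h hmn, fun _ => ⟨1, rfl, fun _ => rfl⟩⟩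
          · rw [PhiAux, if_neg hfix, if_pos hmo]
            simp [alterBar, alterString, col, string_two]
          · rw [if_pos hmo]; rfl
        · obtain ⟨hg1, hg2⟩ := hpos g' (by simp)
          refine ⟨⟨m, g', some g⟩, hs, ?_, rfl, hg2, ?_, ?_,
            fun h => absurd h hmn, fun _ => ⟨0, by simp, fun h => absurd rfl h⟩⟩
          · rw [PhiAux, if_neg hfix, if_pos hmo]
            simp only [alterBar, alterString]
            rw [if_pos (by omega), string_append_string hg2]
            rfl
          · exact (List.suffix_cons _ _).trans (suffix_of_cons_suffix_plusList hsuf)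
          · rw [if_pos hmo]; rfl
      · obtain rfl : o = m := by omega
        rcases hs with _ | ⟨g, hs⟩
        · refine ⟨⟨o, 0, none⟩, [], ?_, rfl, Nat.zero_le _, List.nil_suffix, ?_,
            fun h => absurd h hmn, fun _ => ⟨1, rfl, fun _ => rfl⟩⟩
          · rw [PhiAux, if_neg hfix, if_neg hmo]
            simp [alterString, col, string_two]
          · rw [if_neg hmo]; rfl
        · obtain ⟨hg1, hg2⟩ := hpos g (by simp)
          refine ⟨⟨o, g, none⟩, hs, ?_, rfl, hg2, ?_, ?_,
            fun h => absurd h hmn, fun _ => ⟨0, by simp, fun h => absurd rfl h⟩⟩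
          · rw [PhiAux, if_neg hfix, if_neg hmo]
            simp only [alterString]
            rw [if_pos (by omega), string_append_string hg2]
            simp [col]
          · exact suffix_of_cons_suffix_plusList hsuf
          · rw [if_neg hmo]; rfl

end KRCrystal

namespace KRCrystal

open PMDiagram ColData

theorem YoungDiagram.colLen_mono {μ ν : YoungDiagram} (h : μ ≤ ν) (j : ℕ) :
    μ.colLen j ≤ ν.colLen j := by
  by_contra hc
  push Not at hc
  have := YoungDiagram.mem_iff_lt_colLen.mpr hc
  exact lt_irrefl _ (YoungDiagram.mem_iff_lt_colLen.mp (h this))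

theorem countP_map_range {α : Type} (p : α → Bool) (f : ℕ → α) (k : ℕ) :
    ((List.range k).map f).countP p = ∑ j ∈ Finset.range k, if p (f j) then 1 else 0 := by
  induction k with
  | zero => rfl
  | succ k ih =>
    rw [List.range_succ, List.map_append, List.countP_append, ih, Finset.sum_range_succ]
    simp [List.countP_cons]

theorem ColData.bounded_zero {k : ℕ} {l : List ColData} (hl : ∀ d ∈ l, d.gap ≤ d.mid)
    (h : (heights l).count 0 ≤ numMid 0 l + k) : Bounded 0 k l := by
  induction l with
  | nil => trivial
  | cons d l ih =>
    refine ⟨h, ih (fun d hd => hl d (by simp [hd])) ?_⟩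
    have := hl d (by simp)
    rw [heights_cons, List.count_append, List.count_cons, numMid_cons] at h
    simp only [beq_iff_eq] at h
    split_ifs at h <;> omega

theorem maxRow_le (X : ClassicalType) (n : ℕ) : maxRow X n ≤ n := by
  cases X <;> simp [maxRow]

namespace PMDiagram

variable (P : PMDiagram)

/-- The heights of the outer, the middle and the inner part of the first `k` columns. -/
def columnHeights (k : ℕ) : List (ℕ × ℕ × ℕ) :=
  (List.range k).map fun j => (P.outer.colLen j, P.mid.colLen j, P.inner.colLen j)

theorem plusHeights_eq (n k : ℕ) : P.plusHeights n k = plusList n (P.columnHeights k) := by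
  unfold plusHeights plusList columnHeights
  rw [List.filter_map, List.map_map]
  rfl

theorem Phi_eq (n k : ℕ) :
    P.Phi n k = PhiAux n (P.columnHeights k) (plusList n (P.columnHeights k)) := by
  rw [← plusHeights_eq]; rfl

/-- The left hand side of the inequality in the classification of highest elements. -/
def level (r : ℕ) : ℕ :=
  (∑ i ∈ (Finset.Icc 1 r).filter (fun i => i ≡ r [MOD 2]), (P.numEmpty i + P.numMinus i)) +
    (∑ i ∈ (Finset.Ioc 1 r).filter (fun i => i ≡ r [MOD 2]), (P.numMinus i + P.numBoth i))

theorem sum_card_colLen {r k : ℕ} (hP : P.OuterMem r k) (s : Finset ℕ) (hs : 0 ∉ s)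
    (Q : ℕ → Prop) [DecidablePred Q] :
    ∑ i ∈ s, ((Finset.range (P.outer.rowLen 0)).filter
      (fun j => P.outer.colLen j = i ∧ Q j)).card =
      ∑ j ∈ Finset.range k, if P.outer.colLen j ∈ s ∧ Q j then 1 else 0 := by
  have h1 : ∀ j, j < P.outer.rowLen 0 ↔ 0 < P.outer.colLen j := fun j => by
    rw [← YoungDiagram.mem_iff_lt_rowLen, ← YoungDiagram.mem_iff_lt_colLen]
  have h2 : (Finset.range (P.outer.rowLen 0)).filter (fun j => P.outer.colLen j ∈ s ∧ Q j) =
      (Finset.range k).filter (fun j => P.outer.colLen j ∈ s ∧ Q j) := by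
    ext j
    simp only [Finset.mem_filter, Finset.mem_range, and_congr_left_iff, h1]
    rintro ⟨h3, -⟩
    have h4 : P.outer.colLen j ≠ 0 := fun h => hs (h ▸ h3)
    refine iff_of_true (by omega) ?_
    by_contra hk
    exact h4 (hP.2 j (by omega))
  rw [← Finset.card_filter, ← h2, Finset.card_eq_sum_card_fiberwise
    (f := P.outer.colLen) (t := s) (fun j hj => (Finset.mem_filter.mp hj).2.1)]
  refine Finset.sum_congr rfl fun i hi => ?_
  congr 1
  ext j
  simp only [Finset.mem_filter]
  constructor
  · rintro ⟨h, rfl, h3⟩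
    exact ⟨⟨h, hi, h3⟩, rfl⟩
  · rintro ⟨⟨h, _, h3⟩, rfl⟩
    exact ⟨h, rfl, h3⟩

theorem level_eq {r k : ℕ} (hP : P.OuterMem r k) :
    P.level r = ∑ j ∈ Finset.range k,
      ((if 1 ≤ P.outer.colLen j ∧ ¬ P.HasPlus j then 1 else 0) +
        (if 2 ≤ P.outer.colLen j ∧ P.HasMinus j then 1 else 0)) := by
  have e1 : ∀ i, P.numEmpty i + P.numMinus i = ((Finset.range (P.outer.rowLen 0)).filter
      (fun j => P.outer.colLen j = i ∧ ¬ P.HasPlus j)).card := by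
    intro i
    unfold numEmpty numMinus
    rw [← Finset.card_union_of_disjoint]
    · congr 1
      ext j
      simp only [Finset.mem_union, Finset.mem_filter]
      tauto
    · rw [Finset.disjoint_filter]
      tauto
  have e2 : ∀ i, P.numMinus i + P.numBoth i = ((Finset.range (P.outer.rowLen 0)).filter
      (fun j => P.outer.colLen j = i ∧ P.HasMinus j)).card := by
    intro i
    unfold numMinus numBoth
    rw [← Finset.card_union_of_disjoint]
    · congr 1
      ext j
      simp only [Finset.mem_union, Finset.mem_filter]
      tauto
    · rw [Finset.disjoint_filter]
      tauto
  unfold level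
  simp_rw [e1, e2]
  rw [P.sum_card_colLen hP _ (by simp), P.sum_card_colLen hP _ (by simp),
    ← Finset.sum_add_distrib]
  refine Finset.sum_congr rfl fun j hj => ?_
  obtain ⟨h1, h2⟩ := hP.1 j (Finset.mem_range.mp hj)
  simp only [Finset.mem_filter, Finset.mem_Icc, Finset.mem_Ioc, h1, h2, and_true, Nat.succ_le_iff]

/-- The heights in the columns of a `±`-diagram. -/
theorem columnHeights_spec {X : ClassicalType} {n r k : ℕ} (hn : 2 ≤ n) (hrn : r ≤ maxRow X n)
    (hX : P.IsOfType X n) (hP : P.OuterMem r k) (j : ℕ) :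
    P.inner.colLen j ≤ P.mid.colLen j ∧ P.mid.colLen j ≤ P.outer.colLen j ∧
      P.outer.colLen j ≤ P.mid.colLen j + 1 ∧ P.outer.colLen j ≤ n ∧
      (P.mid.colLen j = n → P.inner.colLen j < P.mid.colLen j) := by
  have h1 := YoungDiagram.colLen_mono P.inner_le_mid j
  have h2 := YoungDiagram.colLen_mono P.mid_le_outer j
  have hor : P.outer.colLen j ≤ r := by
    by_cases hj : j < k
    · exact (hP.1 j hj).1
    · rw [hP.2 j (by omega)]; omega
  refine ⟨h1, h2, P.minus_strip j, hor.trans (hrn.trans (maxRow_le X n)), fun h => ?_⟩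
  cases X
  · simp only [maxRow] at hrn; omega
  · have := (hX rfl j).2; omega
  · simp only [maxRow] at hrn; omega

/-- The columns of the tableau of a `±`-diagram. -/
theorem exists_colData_Phi {X : ClassicalType} {n r k : ℕ} (hn : 2 ≤ n) (hrn : r ≤ maxRow X n)
    (hX : P.IsOfType X n) (hP : P.OuterMem r k) :
    ∃ l : List ColData, P.Phi n k = tab l ∧ (∀ d ∈ l, d.gap ≤ d.mid) ∧
      (heights l).Pairwise (· ≥ ·) ∧ (∀ h, 1 ≤ h → Bounded h 0 l) ∧
      (heights l).count 0 = numMid 0 l + P.level r := by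
  have hspec := P.columnHeights_spec hn hrn hX hP
  have hc : ∀ c ∈ P.columnHeights k, c.2.1 ≤ c.1 ∧ c.1 ≤ c.2.1 + 1 ∧ c.1 ≤ n ∧
      (c.2.1 = n → c.2.2 < c.2.1) := by
    intro c hc
    simp only [columnHeights, List.mem_map] at hc
    obtain ⟨j, -, rfl⟩ := hc
    exact (hspec j).2
  have hm : (P.columnHeights k).Pairwise fun c c' => c'.2.1 ≤ c.2.1 := by
    unfold columnHeights
    rw [List.pairwise_map]
    exact List.pairwise_lt_range.imp fun h => P.mid.colLen_anti _ _ h.le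
  obtain ⟨l, z, h1, h2, h3, h4, h5, h6⟩ :=
    exists_colData_phiAux n (P.columnHeights k) _ hc hm (List.suffix_refl _)
  refine ⟨l, (P.Phi_eq n k).trans h1, h3, ?_, h6, ?_⟩
  · rw [h4, List.pairwise_append, List.pairwise_append]
    have hle : ∀ g ∈ plusList n (P.columnHeights k), g ≤ n := by
      intro g hg
      obtain ⟨-, -, c, hc', rfl⟩ := mem_plusList hg
      have := hc c hc'
      omega
    refine ⟨List.pairwise_replicate.mpr (Or.inr le_rfl),
      ⟨?_, List.pairwise_replicate.mpr (Or.inr le_rfl), ?_⟩, ?_⟩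
    · unfold plusList
      rw [List.pairwise_map]
      exact hm.filter _
    · intro a _ b hb
      rw [List.eq_of_mem_replicate hb]
      exact Nat.zero_le _
    · intro a ha b hb
      rw [List.eq_of_mem_replicate ha]
      rcases List.mem_append.mp hb with hb | hb
      · exact hle b hb
      · rw [List.eq_of_mem_replicate hb]
        exact Nat.zero_le _
  · have hz : (heights l).count 0 = z := by
      rw [h4, List.count_append, List.count_append, List.count_replicate, List.count_replicate,
        List.count_eq_zero.mpr fun h => absurd (mem_plusList h).1 (by omega)]
      simp only [beq_iff_eq]
      rw [if_neg (by omega)]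
      simp
    have hlen := h5
    rw [h4, List.length_append, List.length_append, List.length_replicate,
      List.length_replicate] at hlen
    have hplus : (plusList n (P.columnHeights k)).length =
        (P.columnHeights k).countP fun c => c.2.2 < c.2.1 ∧ c.2.1 ≠ n := by
      rw [plusList, List.length_map, List.countP_eq_length_filter]
    have hzero : numMid 0 l = (P.columnHeights k).countP fun c => c.2.1 = 0 := by
      rw [numMid_eq_count, h2, List.count, List.countP_map]
      rfl
    have hk : (P.columnHeights k).length = ∑ j ∈ Finset.range k, 1 := by
      simp [columnHeights]
    rw [hz, hzero, P.level_eq hP]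
    rw [hplus, hk] at hlen
    simp only [columnHeights, countP_map_range, decide_eq_true_eq] at hlen ⊢
    have key : ∑ j ∈ Finset.range k, (((if P.mid.colLen j = 0 then 1 else 0) +
        ((if 1 ≤ P.outer.colLen j ∧ ¬ P.HasPlus j then 1 else 0) +
        (if 2 ≤ P.outer.colLen j ∧ P.HasMinus j then 1 else 0))) +
        ((if P.mid.colLen j = n then 1 else 0) +
        (if P.inner.colLen j < P.mid.colLen j ∧ P.mid.colLen j ≠ n then 1 else 0))) =
        ∑ j ∈ Finset.range k, (1 + if P.mid.colLen j < P.outer.colLen j then 1 else 0) := by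
      refine Finset.sum_congr rfl fun j _ => ?_
      have := hspec j
      unfold HasPlus HasMinus
      split_ifs <;> omega
    simp only [Finset.sum_add_distrib] at key hlen ⊢
    omega

end PMDiagram

theorem valid_of_mem_word {X : ClassicalType} {n r k : ℕ} {T : Tableau} (hT : T ∈ KR X n r k)
    {a : Letter} (ha : a ∈ T.word) : a.Valid X n := by
  simp only [Tableau.word, List.mem_flatten, List.mem_reverse] at ha
  obtain ⟨C, hC, ha⟩ := ha
  exact (hT.2.2.1 C hC).1 a ha

theorem coeff_eq_zero_of_valid {X : ClassicalType} {n x : ℕ} (hx : n < x) {u : List Letter}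
    (hu : ∀ a ∈ u, a.Valid X n) : coeff x u = 0 := by
  unfold coeff
  have h1 : Letter.pos x ∉ u := fun h =>
    absurd (show 1 ≤ x ∧ x ≤ n from hu _ h).2 (by omega)
  have h2 : Letter.neg x ∉ u := fun h =>
    absurd (show 1 ≤ x ∧ x ≤ n from hu _ h).2 (by omega)
  rw [List.count_eq_zero.mpr h1, List.count_eq_zero.mpr h2]
  rfl

theorem ColData.zero_notMem_word (l : List ColData) : Letter.zero ∉ (tab l).word := by
  simp only [Tableau.word, List.mem_flatten, List.mem_reverse, tab, List.mem_map]
  rintro ⟨C, ⟨d, -, rfl⟩, ha⟩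
  rcases List.mem_append.mp ha with ha | ha
  · obtain ⟨y, hy, -⟩ := exists_of_mem_gapString ha
    simp at hy
  · simp at ha

/-- The tableau of a `±`-diagram has `ε_i = 0` for `i > 1`, and `ε_1` is at most the level. -/
theorem wordLengths_tab_le {X : ClassicalType} {n r k l : ℕ} (hn : 2 ≤ n) (hD : X = .D → 3 ≤ n)
    {L : List ColData} (hT : tab L ∈ KR X n r k) (hL : ∀ d ∈ L, d.gap ≤ d.mid)
    (hb : ∀ h, 1 ≤ h → Bounded h 0 L) (hl : (heights L).count 0 ≤ numMid 0 L + l)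
    {i : ℕ} (hi : 1 ≤ i) (hin : i ≤ n) :
    (Crystal.wordLengths (letterEps X n i) (letterPhi X n i) (tab L).word).1 ≤
      if i = 1 then l else 0 := by
  have hpre : ∀ h, 1 ≤ h → ∀ u, u <+: (tab L).word → 0 ≤ coeff (h + 1) u - coeff (h + 2) u :=
    fun h hh u hu => by simpa using (hb h hh).neg_le_coeff hL hu
  rcases Nat.lt_or_eq_of_le hin with h | rfl
  · rw [wordLengths_fst_le_iff_coeff X h]
    intro u hu
    split_ifs with h1
    · subst h1
      exact (bounded_zero hL hl).neg_le_coeff hL hu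
    · have := hpre (i - 1) (by omega) u hu
      rw [show i - 1 + 1 = i by omega, show i - 1 + 2 = i + 1 by omega] at this
      simpa using this
  · rw [if_neg (by omega), wordLengths_fst_le_iff_prefix]
    · intro u hu
      rw [sum_weight_self X hi]
      have h0 : coeff (i + 1) u = 0 :=
        coeff_eq_zero_of_valid (Nat.lt_succ_self i) fun a ha => valid_of_mem_word hT (hu.subset ha)
      have h1 := hpre (i - 1) (by omega) u hu
      rw [show i - 1 + 1 = i by omega, show i - 1 + 2 = i + 1 by omega, h0] at h1
      cases X
      · dsimp only; push_cast; linarith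
      · dsimp only; push_cast; linarith
      · have h3 := hD rfl
        have h2 := hpre (i - 2) (by omega) u hu
        rw [show i - 2 + 1 = i - 1 by omega, show i - 2 + 2 = i by omega] at h2
        dsimp only; push_cast; linarith
    · rintro (j | _ | j) ha
      · left; simp [letterEps]
      · exact absurd ha (zero_notMem_word L)
      · right; simp [letterPhi]

end KRCrystal

namespace KRCrystal

open ColData

theorem wordLengths_snd_sub_fst {α : Type} (E F : α → ℕ) (w : List α) :
    ((Crystal.wordLengths E F w).2 : ℤ) - (Crystal.wordLengths E F w).1 =
      (w.map fun x => (F x : ℤ) - E x).sum := by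
  induction w with
  | nil => rfl
  | cons a w ih =>
    rw [List.map_cons, List.sum_cons, ← ih]
    simp only [Crystal.wordLengths]
    omega

/-- The word is killed by `e_i` for `2 ≤ i ≤ n`. -/
def LeviHighest (X : ClassicalType) (n : ℕ) (w : List Letter) : Prop :=
  ∀ i, 2 ≤ i → i ≤ n →
    (Crystal.wordLengths (letterEps X n i) (letterPhi X n i) w).1 = 0

theorem LeviHighest.left {X : ClassicalType} {n : ℕ} {u v : List Letter}
    (h : LeviHighest X n (u ++ v)) : LeviHighest X n u := by
  intro i hi hin
  have := h i hi hin
  rw [← Nat.le_zero, Crystal.wordLengths_fst_le_iff] at this ⊢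
  rintro u' a v' rfl
  exact this u' a (v' ++ v) (by simp)

theorem LeviHighest.eps_le {X : ClassicalType} {n i : ℕ} {u : List Letter} {a : Letter}
    (h : LeviHighest X n (u ++ [a])) (hi : 2 ≤ i) (hin : i ≤ n) :
    (letterEps X n i a : ℤ) ≤
      (u.map fun x => (letterPhi X n i x : ℤ) - letterEps X n i x).sum := by
  have := h i hi hin
  rw [← Nat.le_zero, Crystal.wordLengths_fst_le_iff] at this
  simpa using this u a [] rfl

theorem LeviHighest.sum_nonneg {X : ClassicalType} {n i : ℕ} {u : List Letter}
    (h : LeviHighest X n u) (hi : 2 ≤ i) (hin : i ≤ n) :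
    0 ≤ (u.map fun x => (letterPhi X n i x : ℤ) - letterEps X n i x).sum := by
  rw [← wordLengths_snd_sub_fst, h i hi hin]
  simp

/-- In type `D`, neither `n` nor `n̄` occurs. -/
def AvoidsSpin (X : ClassicalType) (n : ℕ) (w : List Letter) : Prop :=
  X = .D → Letter.pos n ∉ w ∧ Letter.neg n ∉ w

theorem AvoidsSpin.coeff_eq_zero {n : ℕ} {w : List Letter} (h : AvoidsSpin .D n w) :
    coeff n w = 0 := by
  rw [coeff, List.count_eq_zero.mpr (h rfl).1, List.count_eq_zero.mpr (h rfl).2]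
  rfl

theorem AvoidsSpin.append {X : ClassicalType} {n : ℕ} {u v : List Letter}
    (hu : AvoidsSpin X n u) (hv : AvoidsSpin X n v) : AvoidsSpin X n (u ++ v) := by
  intro h
  simp only [List.mem_append, not_or]
  exact ⟨⟨(hu h).1, (hv h).1⟩, (hu h).2, (hv h).2⟩

theorem LeviHighest.coeff_succ_le {X : ClassicalType} {n i : ℕ} {w : List Letter}
    (h : LeviHighest X n w) (hi : 2 ≤ i) (hin : i < n) : coeff (i + 1) w ≤ coeff i w := by
  have := h.sum_nonneg hi hin.le
  rw [sum_weight_of_lt X hin] at this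
  linarith

theorem LeviHighest.coeff_last_nonneg {X : ClassicalType} {n : ℕ} {w : List Letter}
    (h : LeviHighest X n w) (hn : 2 ≤ n) (hw : AvoidsSpin X n w) : 0 ≤ coeff n w := by
  have := h.sum_nonneg hn le_rfl
  rw [sum_weight_self X (by omega)] at this
  cases X
  · dsimp only at this; linarith
  · exact this
  · rw [hw.coeff_eq_zero]

theorem LeviHighest.coeff_nonneg {X : ClassicalType} {n i : ℕ} {w : List Letter}
    (h : LeviHighest X n w) (hw : AvoidsSpin X n w) (hi : 2 ≤ i) (hin : i ≤ n) :
    0 ≤ coeff i w := by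
  induction hin using Nat.decreasingInduction with
  | self => exact h.coeff_last_nonneg hi hw
  | of_succ j hj ih => exact (ih (by omega)).trans (h.coeff_succ_le hi hj)

theorem mem_of_coeff_pos {x : ℕ} {w : List Letter} (h : 0 < coeff x w) : Letter.pos x ∈ w := by
  rw [coeff] at h
  exact List.count_pos_iff.mp (by omega)

theorem LeviHighest.pos_mem_of_pos {X : ClassicalType} {n x : ℕ} {w : List Letter}
    (h : LeviHighest X n (w ++ [.pos (x + 1)])) (hw : AvoidsSpin X n w) (hx : 2 ≤ x)
    (hxn : x < n) : Letter.pos x ∈ w := by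
  have h1 := h.eps_le hx hxn.le
  rw [sum_weight_of_lt X hxn] at h1
  have h2 := h.left.coeff_nonneg hw (show 2 ≤ x + 1 by omega) hxn
  simp [letterEps, hxn] at h1
  exact mem_of_coeff_pos (by linarith)

theorem LeviHighest.pos_mem_of_neg {X : ClassicalType} {n x : ℕ} {w : List Letter}
    (h : LeviHighest X n (w ++ [.neg x])) (hw : AvoidsSpin X n w) (hx : 2 ≤ x) (hxn : x ≤ n)
    (hX : X = .D → x ≠ n) : Letter.pos x ∈ w := by
  have h1 := h.eps_le hx hxn
  apply mem_of_coeff_pos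
  rcases Nat.lt_or_eq_of_le hxn with hxn | rfl
  · rw [sum_weight_of_lt X hxn] at h1
    have h2 := h.left.coeff_nonneg hw (show 2 ≤ x + 1 by omega) hxn
    simp [letterEps, hxn] at h1
    linarith
  · rw [sum_weight_self X (by omega)] at h1
    cases X <;> simp [letterEps] at h1 hX <;> omega

theorem LeviHighest.pos_mem_of_neg_last {n : ℕ} {w : List Letter}
    (h : LeviHighest .D n (w ++ [.neg n])) (hw : AvoidsSpin .D n w) (hn : 2 ≤ n) :
    Letter.pos (n - 1) ∈ w := by
  have h1 := h.eps_le hn le_rfl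
  rw [sum_weight_self _ (by omega)] at h1
  simp [letterEps, hw.coeff_eq_zero] at h1
  exact mem_of_coeff_pos (by omega)

theorem LeviHighest.pos_mem_of_zero {n : ℕ} {w : List Letter}
    (h : LeviHighest .B n (w ++ [.zero])) (hn : 2 ≤ n) : Letter.pos n ∈ w := by
  have h1 := h.eps_le hn le_rfl
  rw [sum_weight_self _ (by omega)] at h1
  simp [letterEps] at h1
  exact mem_of_coeff_pos (by omega)

theorem not_rowStep_neg_pos {X : ClassicalType} {n g y : ℕ} :
    ¬ RowStep X n (.neg g) (.pos y) := by
  simp [RowStep, Letter.LT]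

theorem le_of_rowStep_pos {X : ClassicalType} {n x y : ℕ}
    (h : RowStep X n (.pos x) (.pos y)) : x ≤ y := by
  rcases h with h | h
  · exact le_of_lt h
  · rw [Letter.pos.inj h.1]

theorem lt_of_colStep_pos {X : ClassicalType} {n x y : ℕ}
    (h : ColStep X n (.pos x) (.pos y)) : x < y := by
  rcases h with h | h | h
  · exact h
  · simp at h
  · simp at h

theorem lt_of_colStep_neg {X : ClassicalType} {n g : ℕ} {a : Letter}
    (h : ColStep X n (.neg g) a) (hX : X = .D → g ≠ n) : ∃ b < g, a = .neg b := by
  rcases h with h | h | h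
  · rcases a with b | _ | b
    · exact h.elim
    · exact h.elim
    · exact ⟨b, h, rfl⟩
  · simp at h
  · obtain ⟨hD, h | h⟩ := h
    · simp at h
    · exact absurd (Letter.neg.inj h.1) (hX hD)

theorem avoidsSpin_gapString {X : ClassicalType} {n h m : ℕ} (hm : X = .D → m + 1 < n) :
    AvoidsSpin X n (gapString h m) := by
  intro hD
  have := hm hD
  constructor <;> intro hmem <;> obtain ⟨y, hy, h1, h2⟩ := exists_of_mem_gapString hmem
  · have := Letter.pos.inj hy
    omega
  · simp at hy

/-- The form of a column that continues the word `u` of the columns to its right to a highest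
word; `M` is such that the rows up to height `M` continue to the right with unbarred letters. -/
theorem exists_colData_of_leviHighest {X : ClassicalType} {n M : ℕ} {u L : List Letter}
    (hn : 2 ≤ n) (hL : IsKNColumn X n L) (hlen : L.length ≤ maxRow X n)
    (hu : ∀ x, Letter.pos x ∈ u → x ≤ M + 1) (hspin : AvoidsSpin X n u)
    (hrow : ∀ j a, L[j]? = some a → j < M → ∃ y ≤ j + 2, RowStep X n a (.pos y))
    (hhigh : LeviHighest X n (u ++ L)) (h : ℕ) (p q : List Letter) (hpq : L = p ++ q)
    (hp : p = gapString h p.length) :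
    ∃ d : ColData, L = d.col ∧ d.gap ≤ d.mid ∧ ∀ g ∈ d.bar, g ≤ d.mid := by
  induction q generalizing p h with
  | nil =>
    refine ⟨⟨p.length, min h p.length, none⟩, ?_, min_le_right _ _, by simp⟩
    rw [hpq]
    simp only [col, Option.toList_none, List.map_nil, List.append_nil]
    conv_lhs => rw [hp]
    by_cases hh : h ≤ p.length
    · rw [min_eq_left hh]
    · rw [min_eq_right (by omega)]
      exact gapString_congr (by omega) le_rfl
  | cons a q ih =>
    set i := p.length with hi
    have hiL : i < L.length := by rw [hpq]; simp [hi]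
    have hin : i < maxRow X n := by omega
    have hai : L[i]? = some a := by rw [hpq, hi]; simp
    have hval : a.Valid X n := hL.1 a (by rw [hpq]; simp)
    have hhigh' : LeviHighest X n ((u ++ p) ++ [a]) := by
      have : u ++ L = (u ++ p ++ [a]) ++ q := by rw [hpq]; simp
      rw [this] at hhigh
      exact hhigh.left
    have hspin' : AvoidsSpin X n (u ++ p) := by
      refine hspin.append ?_
      rw [hp]
      refine avoidsSpin_gapString ?_
      rintro rfl
      simp only [maxRow] at hin
      omega
    have hpget : ∀ j < i, L[j]? = some (.pos (if j < h then j + 1 else j + 2)) := by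
      intro j hj
      rw [hpq, List.getElem?_append_left hj, hp, getElem?_gapString hj]
    -- a letter that is too large for its row has only small letters before it
    have hsmall : (∀ y, a = .pos y → i + 2 < y) → ∀ x, Letter.pos x ∈ u ++ p → x ≤ i + 1 := by
      intro ha x hx
      rcases List.mem_append.mp hx with hx | hx
      · have hxM := hu x hx
        have hMi : ¬ i < M := by
          intro hiM
          obtain ⟨y, hy, hstep⟩ := hrow i a hai hiM
          rcases a with y' | _ | g
          · have := ha y' rfl
            have := le_of_rowStep_pos hstep
            omega
          · simp [RowStep, Letter.LT] at hstep
          · exact not_rowStep_neg_pos hstep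
        omega
      · rw [hp] at hx
        obtain ⟨y, hy, h1, h2⟩ := exists_of_mem_gapString hx
        rw [Letter.pos.inj hy]
        exact h2
    have hstepL : ∀ j b c, L[j]? = some b → L[j + 1]? = some c → ColStep X n b c := by
      intro j b c hb hc
      obtain ⟨hj, rfl⟩ := List.getElem?_eq_some_iff.mp hb
      obtain ⟨hj', rfl⟩ := List.getElem?_eq_some_iff.mp hc
      exact List.isChain_iff_getElem.mp hL.2.1 j hj'
    rcases a with x | _ | g
    · -- an unbarred letter
      obtain ⟨hx1, hxn⟩ := hval
      have hxi : (if i ≤ h then i else i + 1) < x := by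
        rcases Nat.eq_zero_or_pos i with h0 | h0
        · rw [if_pos (by omega)]; omega
        · have h1 := hpget (i - 1) (by omega)
          have h2 := hstepL (i - 1) _ _ h1 (by rw [show i - 1 + 1 = i by omega]; exact hai)
          have h3 := lt_of_colStep_pos h2
          split_ifs at h3 ⊢ <;> omega
      have hx2 : x ≤ i + 2 := by
        by_contra hx
        push Not at hx
        obtain ⟨x, rfl⟩ : ∃ y, x = y + 1 := ⟨x - 1, by omega⟩
        have h1 := hhigh'.pos_mem_of_pos hspin' (by omega) (by omega)
        have h2 := hsmall (fun y hy => by rw [← Letter.pos.inj hy]; omega) x h1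
        omega
      have hnext : ∃ h', p ++ [Letter.pos x] = gapString h' (i + 1) := by
        by_cases hih : i ≤ h
        · rw [if_pos hih] at hxi
          by_cases hx3 : x = i + 1
          · refine ⟨i + 1, ?_⟩
            rw [gapString_succ, if_pos (by omega), hp, hx3,
              gapString_congr hih (Nat.le_succ i)]
          · refine ⟨i, ?_⟩
            rw [gapString_succ, if_neg (by omega), hp, show x = i + 2 by omega,
              gapString_congr hih le_rfl]
        · rw [if_neg hih] at hxi
          refine ⟨h, ?_⟩
          rw [gapString_succ, if_neg (by omega), show x = i + 2 by omega, ← hp]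
      obtain ⟨h', hnext⟩ := hnext
      exact ih h' (p ++ [.pos x]) (by rw [hpq]; simp) (by
        rw [List.length_append, ← hi]; exact hnext)
    · -- the letter zero
      exfalso
      have hB : X = .B := hval
      subst hB
      have h1 := hsmall (by simp) n (hhigh'.pos_mem_of_zero hn)
      simp only [maxRow] at hin
      omega
    · -- a barred letter
      obtain ⟨hg1, hgn⟩ := hval
      have hD : X = .D → g ≠ n := by
        rintro rfl rfl
        have h1 := hsmall (by simp) _ (hhigh'.pos_mem_of_neg_last hspin' hn)
        simp only [maxRow] at hin
        omega
      have hgi : g ≤ i + 1 := by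
        by_cases hg : g = 1
        · omega
        · exact hsmall (by simp) g (hhigh'.pos_mem_of_neg hspin' (by omega) hgn hD)
      have hq : q = [] := by
        rcases q with _ | ⟨c, q⟩
        · rfl
        · exfalso
          have hci : L[i + 1]? = some c := by
            rw [hpq, List.getElem?_append_right (by omega)]
            simp [hi]
          have hcval : c.Valid X n := hL.1 c (by rw [hpq]; simp)
          obtain ⟨b, hbg, rfl⟩ := lt_of_colStep_neg (hstepL i _ _ hai hci) hD
          obtain ⟨hb1, hbn⟩ := hcval
          have hlen2 : i + 2 ≤ L.length := by rw [hpq]; simp [hi]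
          by_cases hgh : g ≤ h
          · have h1 := hpget (g - 1)
            by_cases hg : g - 1 < i
            · have h2 := h1 hg
              rw [if_pos (by omega), show g - 1 + 1 = g by omega] at h2
              have := hL.2.2 g hgn i hiL (g - 1) hg h2 hai
              omega
            · -- then `b` occurs below
              have h2 := hpget (b - 1) (by omega)
              rw [if_pos (by omega), show b - 1 + 1 = b by omega] at h2
              have := hL.2.2 b hbn (i + 1) (by omega) (b - 1) (by omega) h2 hci
              omega
          · by_cases hgh' : g = h + 1
            · have h2 := hpget (b - 1) (by omega)
              rw [if_pos (by omega), show b - 1 + 1 = b by omega] at h2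
              have := hL.2.2 b hbn (i + 1) (by omega) (b - 1) (by omega) h2 hci
              omega
            · have h2 := hpget (g - 2) (by omega)
              rw [if_neg (by omega), show g - 2 + 2 = g by omega] at h2
              have := hL.2.2 g hgn i hiL (g - 2) (by omega) h2 hai
              omega
      subst hq
      refine ⟨⟨i, min h i, some (g - 1)⟩, ?_, min_le_right _ _, by simp; omega⟩
      rw [hpq]
      simp only [col, Option.toList_some, List.map_cons, List.map_nil]
      rw [show g - 1 + 1 = g by omega]
      congr 1
      rw [hp]
      by_cases hh : h ≤ i
      · rw [min_eq_left hh]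
      · rw [min_eq_right (by omega)]
        exact gapString_congr (by omega) le_rfl

end KRCrystal

namespace KRCrystal

open ColData

namespace ColData

theorem length_col (d : ColData) : d.col.length = d.mid + d.bar.toList.length := by
  simp [col]

theorem getElem?_col {d : ColData} {j : ℕ} (hj : j < d.mid) :
    d.col[j]? = some (.pos (if j < d.gap then j + 1 else j + 2)) := by
  rw [col, List.getElem?_append_left (by simpa using hj), getElem?_gapString hj]

theorem getElem?_col_mid {d : ColData} {g : ℕ} (hg : d.bar = some g) :
    d.col[d.mid]? = some (.neg (g + 1)) := by
  rw [col, List.getElem?_append_right (by simp)]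
  simp [hg]

/-- The columns of a highest tableau. -/
structure Good (l : List ColData) : Prop where
  gap_le : ∀ d ∈ l, d.gap ≤ d.mid
  bar_le : ∀ d ∈ l, ∀ g ∈ d.bar, g ≤ d.mid
  mid_anti : l.Pairwise fun d e => e.mid ≤ d.mid
  heights_anti : (heights l).Pairwise (· ≥ ·)

theorem le_of_pos_mem_col {d : ColData} {x : ℕ} (h : Letter.pos x ∈ d.col) : x ≤ d.mid + 1 := by
  rcases List.mem_append.mp h with h | h
  · obtain ⟨y, hy, h1, h2⟩ := exists_of_mem_gapString h
    rwa [Letter.pos.inj hy]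
  · simp at h

theorem le_of_neg_mem_col {d : ColData} {x : ℕ} (h : Letter.neg x ∈ d.col)
    (hd : ∀ g ∈ d.bar, g ≤ d.mid) : x ≤ d.mid + 1 := by
  rcases List.mem_append.mp h with h | h
  · obtain ⟨y, hy, h1, h2⟩ := exists_of_mem_gapString h
    simp at hy
  · simp only [List.mem_map, Option.mem_toList] at h
    obtain ⟨g, hg, hx⟩ := h
    have := hd g hg
    have := Letter.neg.inj hx
    omega

theorem mem_word_tab {l : List ColData} {a : Letter} (ha : a ∈ (tab l).word) :
    ∃ d ∈ l, a ∈ d.col := by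
  simp only [Tableau.word, List.mem_flatten, List.mem_reverse, tab, List.mem_map] at ha
  obtain ⟨C, ⟨d, hd, rfl⟩, ha⟩ := ha
  exact ⟨d, hd, ha⟩

theorem gap_le_bar {X : ClassicalType} {n : ℕ} {d : ColData} (hd : IsKNColumn X n d.col)
    (hgap : d.gap ≤ d.mid) {g : ℕ} (hg : d.bar = some g) : d.gap ≤ g := by
  by_contra hlt
  push Not at hlt
  have h1 := getElem?_col (d := d) (j := g) (by omega)
  rw [if_pos hlt] at h1
  have h2 := getElem?_col_mid hg
  have hval : 1 ≤ g + 1 ∧ g + 1 ≤ n := hd.1 _ (List.mem_of_getElem? h2)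
  have := hd.2.2 (g + 1) hval.2 d.mid (by rw [length_col, hg]; simp) g (by omega) h1 h2
  rw [length_col, hg] at this
  simp at this

theorem compare_of_isKNPair {X : ClassicalType} {n : ℕ} {d e : ColData}
    (h : IsKNPair X n d.col e.col) (hd : d.gap ≤ d.mid) (he : e.gap ≤ e.mid)
    (hbar : ∀ g ∈ e.bar, g ≤ e.mid) (hlen : e.col.length ≤ maxRow X n) (hn : 2 ≤ n) :
    e.mid ≤ d.mid ∧ e.gap ≤ d.gap ∧ ∀ g ∈ e.bar, g ≤ d.gap := by
  obtain ⟨hl, hrow, hAB, -⟩ := h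
  have hrow' : ∀ (j : ℕ) a b, d.col[j]? = some a → e.col[j]? = some b → RowStep X n a b := by
    intro j a b ha hb
    refine hrow (a, b) (List.mem_of_getElem? (i := j) ?_)
    rw [List.getElem?_zip_eq_some]
    exact ⟨ha, hb⟩
  rw [length_col, length_col] at hl
  have hmid : e.mid ≤ d.mid := by
    by_contra hlt
    push Not at hlt
    rcases hb : d.bar with _ | g
    · rw [hb] at hl; simp at hl; omega
    · exact not_rowStep_neg_pos (hrow' d.mid _ _ (getElem?_col_mid hb) (getElem?_col hlt))
  have hgap : e.gap ≤ d.gap := by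
    by_contra hlt
    push Not at hlt
    have h1 := hrow' d.gap _ _ (getElem?_col (by omega)) (getElem?_col (by omega))
    rw [if_neg (by omega), if_pos hlt] at h1
    have := le_of_rowStep_pos h1
    omega
  refine ⟨hmid, hgap, fun g hg => ?_⟩
  by_contra hlt
  push Not at hlt
  have hge := hbar g hg
  have hg' : e.bar = some g := hg
  rw [length_col, hg'] at hlen
  simp only [Option.toList_some, List.length_singleton] at hlen
  have h1 := getElem?_col (d := d) (j := g - 1) (by omega)
  have h2 := getElem?_col (d := e) (j := g - 1) (by omega)
  rw [if_neg (by omega), show g - 1 + 2 = g + 1 by omega] at h1 h2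
  have h3 := getElem?_col_mid hg'
  have hle := maxRow_le X n
  have := hAB (g + 1) (by omega)
    (by
      cases X
      · right; simp only [maxRow] at hlen; omega
      · left; rfl
      · right; simp only [maxRow] at hlen; omega)
    (g + 1) le_rfl e.mid (by rw [length_col, hg']; simp) e.mid le_rfl (g - 1) (by omega)
    (g - 1) le_rfl h1 h3 (Or.inr ⟨h2, h3⟩)
  omega

end ColData

/-- Highest KN tableaux have columns as described by `ColData`. -/
theorem exists_good_of_leviHighest {X : ClassicalType} {n : ℕ} (hn : 2 ≤ n) {T : Tableau}
    (hT : IsKNTableau X n T) (hlen : ∀ C ∈ T, C.length ≤ maxRow X n)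
    (hhigh : LeviHighest X n T.word) : ∃ l, T = tab l ∧ Good l := by
  induction T with
  | nil => exact ⟨[], rfl, by simp, by simp, by simp, by simp⟩
  | cons C T ih =>
    rw [word_cons] at hhigh
    obtain ⟨hcol, hchain⟩ := hT
    obtain ⟨l, rfl, hl⟩ := ih ⟨fun D hD => hcol D (by simp [hD]), (List.isChain_cons.mp hchain).2⟩
      (fun D hD => hlen D (by simp [hD])) hhigh.left
    have hC := hcol C (by simp)
    have hlenC := hlen C (by simp)
    have hspin : AvoidsSpin X n (tab l).word := by
      rintro rfl
      have hle : ∀ d ∈ l, d.mid + 1 < n := by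
        intro d hd
        have := hlen d.col (by simp [tab]; exact Or.inr ⟨d, hd, rfl⟩)
        rw [length_col] at this
        simp only [maxRow] at this hlenC
        omega
      constructor <;> intro hmem <;> obtain ⟨d, hd, hmem⟩ := mem_word_tab hmem
      · have := le_of_pos_mem_col hmem
        have := hle d hd
        omega
      · have := le_of_neg_mem_col hmem (hl.bar_le d hd)
        have := hle d hd
        omega
    have hform : ∃ d : ColData, C = d.col ∧ d.gap ≤ d.mid ∧ ∀ g ∈ d.bar, g ≤ d.mid := by
      rcases l with _ | ⟨e, l⟩
      · exact exists_colData_of_leviHighest (M := 0) hn hC hlenC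
          (by simp [tab, Tableau.word]) hspin (by simp) hhigh 0 [] C rfl rfl
      · have hp : IsKNPair X n C e.col := (List.isChain_cons_cons.mp hchain).1
        refine exists_colData_of_leviHighest (M := e.mid) hn hC hlenC ?_ hspin ?_ hhigh 0 [] C
          rfl rfl
        · intro x hx
          obtain ⟨d, hd, hx⟩ := mem_word_tab hx
          have := le_of_pos_mem_col hx
          rcases List.mem_cons.mp hd with rfl | hd
          · exact this
          · have := (List.pairwise_cons.mp hl.mid_anti).1 d hd
            omega
        · intro j a ha hj
          refine ⟨if j < e.gap then j + 1 else j + 2, by split_ifs <;> omega, ?_⟩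
          refine hp.2.1 (a, _) (List.mem_of_getElem? (i := j) ?_)
          rw [List.getElem?_zip_eq_some]
          exact ⟨ha, getElem?_col hj⟩
    obtain ⟨d, rfl, hd1, hd2⟩ := hform
    refine ⟨d :: l, rfl, ?_, ?_, ?_, ?_⟩
    · simpa [hd1] using hl.gap_le
    · intro e he
      rcases List.mem_cons.mp he with rfl | he
      · exact hd2
      · exact hl.bar_le e he
    all_goals
      have hcomp : ∀ e l', l = e :: l' → e.mid ≤ d.mid ∧ e.gap ≤ d.gap ∧ ∀ g ∈ e.bar, g ≤ d.gap := by
        rintro e l' rfl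
        exact compare_of_isKNPair (List.isChain_cons_cons.mp hchain).1 hd1
          (hl.gap_le e (by simp)) (hl.bar_le e (by simp)) (hlen _ (by simp [tab])) hn
    · refine List.pairwise_cons.mpr ⟨?_, hl.mid_anti⟩
      intro e he
      rcases l with _ | ⟨e', l⟩
      · simp at he
      · have h1 := (hcomp e' l rfl).1
        rcases List.mem_cons.mp he with rfl | he
        · exact h1
        · exact ((List.pairwise_cons.mp hl.mid_anti).1 e he).trans h1
    · have hgap : ∀ x ∈ heights l, x ≤ d.gap := by
        intro x hx
        rcases l with _ | ⟨e, l⟩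
        · simp at hx
        · obtain ⟨-, h2, h3⟩ := hcomp e l rfl
          have hs := hl.heights_anti
          rw [heights_cons] at hs hx
          rcases hb : e.bar with _ | g
          · rw [hb, Option.toList_none, List.nil_append] at hs hx
            rcases List.mem_cons.mp hx with rfl | hx
            · exact h2
            · exact ((List.pairwise_cons.mp hs).1 x hx).trans h2
          · rw [hb, Option.toList_some, List.singleton_append] at hs hx
            have h4 := h3 g hb
            rcases List.mem_cons.mp hx with rfl | hx
            · exact h4
            · exact ((List.pairwise_cons.mp hs).1 x hx).trans h4
      rw [heights_cons, List.pairwise_append, List.pairwise_cons]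
      refine ⟨?_, ⟨hgap, hl.heights_anti⟩, ?_⟩
      · rcases d.bar with _ | g <;> simp
      · intro g hg x hx
        have h5 : d.gap ≤ g := gap_le_bar hC hd1 (by simpa using hg)
        rcases List.mem_cons.mp hx with rfl | hx
        · exact h5
        · exact (hgap x hx).trans h5

/-- In a highest tableau, every height `h ≥ 1` is the height of at most as many alterations as there
are columns with `mid = h`. -/
theorem count_heights_le {X : ClassicalType} {n r k : ℕ} (hn : 2 ≤ n) (hrn : r ≤ maxRow X n)
    {l : List ColData}
    (hT : tab l ∈ KR X n r k) (hl : Good l) (hhigh : LeviHighest X n (tab l).word) {h : ℕ}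
    (hh : 1 ≤ h) : (heights l).count h ≤ numMid h l := by
  have := count_le_of_neg_le_coeff (h := h) (k := 0) hl.heights_anti hl.gap_le ?_
  · simpa using this
  intro u hu
  have hval : ∀ a ∈ u, a.Valid X n := fun a ha => valid_of_mem_word hT (hu.subset ha)
  obtain ⟨v, hv⟩ := hu
  rw [← hv] at hhigh
  have hhigh := hhigh.left
  rcases lt_trichotomy (h + 1) n with hlt | heq | hgt
  · have := hhigh.coeff_succ_le (by omega) hlt
    push_cast
    linarith
  · have hspin : AvoidsSpin X n u := by
      rintro rfl
      have hle : ∀ d ∈ l, d.mid + 1 < n := by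
        intro d hd
        have := (hT.2.1 d.col (by simp [tab]; exact ⟨d, hd, rfl⟩)).1
        rw [length_col] at this
        simp only [maxRow] at this hrn
        omega
      constructor <;> intro hmem <;>
        obtain ⟨d, hd, hmem⟩ := mem_word_tab (l := l) (by rw [← hv]; exact List.mem_append_left _ hmem)
      · have := le_of_pos_mem_col hmem
        have := hle d hd
        omega
      · have := le_of_neg_mem_col hmem (hl.bar_le d hd)
        have := hle d hd
        omega
    have h1 := hhigh.coeff_last_nonneg hn hspin
    have h2 : coeff (h + 2) u = 0 := coeff_eq_zero_of_valid (by omega) hval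
    rw [heq, h2]
    simpa using h1
  · rw [coeff_eq_zero_of_valid (by omega) hval, coeff_eq_zero_of_valid (by omega) hval]
    simp

end KRCrystal

namespace KRCrystal

open ColData PMDiagram

theorem filter_eq_nil_of_head_zero {n : ℕ} {s : List ℕ} (h : ∀ x ∈ s, 0 ≥ x) :
    s.filter (fun x => 0 < x ∧ x ≠ n) = [] := by
  rw [List.filter_eq_nil_iff]
  intro x hx
  have := h x hx
  simp only [decide_eq_true_eq]
  omega

/-- `PhiAux` recovers a highest tableau from the shapes of its columns and its nonzero heights. -/
theorem phiAux_eq_tab {n : ℕ} {l : List ColData} {cols : List (ℕ × ℕ × ℕ)}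
    (hcols : List.Forall₂ (fun d c => c.2.1 = d.mid ∧ c.1 = d.mid + d.bar.toList.length ∧
      (d.mid = n → c.2.2 < c.2.1)) l cols)
    (hl : Good l) (hmid : ∀ d ∈ l, d.mid ≤ n ∧ (d.mid = n → d.gap = n ∧ d.bar = none)) :
    PhiAux n cols ((heights l).filter fun x => 0 < x ∧ x ≠ n) = tab l := by
  induction hcols with
  | nil => simp [PhiAux, tab]
  | @cons d c l cols hdc hcols ih =>
    obtain ⟨o, m, i⟩ := c
    obtain ⟨rfl, rfl, hfix⟩ := hdc
    obtain ⟨hdn, hd⟩ := hmid d (by simp)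
    have hgap := hl.gap_le d (by simp)
    have hbar := hl.bar_le d (by simp)
    have hs := hl.heights_anti
    rw [heights_cons, List.pairwise_append, List.pairwise_cons] at hs
    obtain ⟨-, ⟨hs1, hs2⟩, hs3⟩ := hs
    have ih := ih ⟨fun d hd => hl.gap_le d (by simp [hd]), fun d hd => hl.bar_le d (by simp [hd]),
      (List.pairwise_cons.mp hl.mid_anti).2, hs2⟩ fun d hd => hmid d (by simp [hd])
    have hnil : d.gap = 0 → (heights l).filter (fun x => 0 < x ∧ x ≠ n) = [] := fun h0 =>
      filter_eq_nil_of_head_zero (by rwa [h0] at hs1)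
    have htab : tab (d :: l) = d.col :: tab l := rfl
    rw [htab, ← ih, heights_cons]
    dsimp only at hfix ⊢
    by_cases hn : d.mid = n
    · obtain ⟨h1, h2⟩ := hd hn
      rw [PhiAux, if_pos ⟨hn, hfix hn⟩]
      simp [h2, h1, col, hn, string_one]
    · have hcond : ¬ (d.mid = n ∧ i < d.mid) := fun h => hn h.1
      rw [PhiAux, if_neg hcond]
      obtain ⟨m, h, b⟩ := d
      dsimp only at *
      rcases b with _ | g
      · simp only [Option.toList_none, List.length_nil, Nat.add_zero, lt_irrefl, if_false,
          List.nil_append]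
        rcases Nat.eq_zero_or_pos h with rfl | hpos
        · rw [List.filter_cons_of_neg (by simp), hnil rfl]
          simp [alterString, string_two, col]
        · rw [List.filter_cons_of_pos (by simp; omega)]
          simp only [alterString]
          rw [if_pos (by omega), string_append_string hgap]
          simp [col]
      · have hgm := hbar g rfl
        have hhg : h ≤ g := hs3 g (by simp) h (by simp)
        simp only [Option.toList_some, List.length_singleton, Nat.lt_succ_self, if_true,
          List.singleton_append]
        rcases Nat.eq_zero_or_pos g with rfl | hgpos
        · obtain rfl : h = 0 := by omega
          rw [List.filter_cons_of_neg (by simp), List.filter_cons_of_neg (by simp), hnil rfl]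
          simp [alterBar, alterString, string_two, col]
        · rw [List.filter_cons_of_pos (by simp; omega)]
          rcases Nat.eq_zero_or_pos h with rfl | hpos
          · rw [List.filter_cons_of_neg (by simp), hnil rfl]
            simp [alterBar, alterString, string_two, col]
          · rw [List.filter_cons_of_pos (by simp; omega)]
            simp only [alterBar, alterString]
            rw [if_pos (by omega), string_append_string hgap]
            simp [col]

/-- The Young diagram with given column lengths. -/
def youngOfColLens (f : ℕ → ℕ) (k : ℕ) (hf : Antitone f) : YoungDiagram where
  cells := (Finset.range (f 0) ×ˢ Finset.range k).filter fun c => c.1 < f c.2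
  isLowerSet := by
    rintro ⟨i, j⟩ ⟨i', j'⟩ ⟨h1, h2⟩ h
    simp only [Finset.coe_filter, Finset.mem_product, Finset.mem_range, Set.mem_ofPred_eq] at h ⊢
    dsimp only at h1 h2
    have := hf h2
    omega

theorem colLen_youngOfColLens (f : ℕ → ℕ) (k : ℕ) (hf : Antitone f) (h0 : ∀ j, k ≤ j → f j = 0)
    (j : ℕ) : (youngOfColLens f k hf).colLen j = f j := by
  have key : ∀ i, i < (youngOfColLens f k hf).colLen j ↔ i < f j := by
    intro i
    rw [← YoungDiagram.mem_iff_lt_colLen, ← YoungDiagram.mem_cells]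
    simp only [youngOfColLens, Finset.mem_filter, Finset.mem_product, Finset.mem_range]
    refine ⟨fun h => h.2, fun h => ⟨⟨h.trans_le (hf (Nat.zero_le j)), ?_⟩, h⟩⟩
    by_contra hk
    have := h0 j (by omega)
    omega
  have h1 := key (f j)
  have h2 := key ((youngOfColLens f k hf).colLen j)
  omega

theorem youngDiagram_le_of_colLen_le {μ ν : YoungDiagram} (h : ∀ j, μ.colLen j ≤ ν.colLen j) :
    μ ≤ ν := by
  rintro ⟨i, j⟩ hij
  exact YoungDiagram.mem_iff_lt_colLen.mpr ((YoungDiagram.mem_iff_lt_colLen.mp hij).trans_le (h j))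

theorem antitone_getD {s : List ℕ} (hs : s.Pairwise (· ≥ ·)) : Antitone fun j => s.getD j 0 := by
  intro i j hij
  dsimp only
  rcases hij.lt_or_eq with hij | rfl
  · by_cases hj : j < s.length
    · rw [List.getD_eq_getElem _ _ hj, List.getD_eq_getElem _ _ (hij.trans hj)]
      exact List.pairwise_iff_getElem.mp hs i j (hij.trans hj) hj hij
    · rw [List.getD_eq_default _ _ (by omega)]
      exact Nat.zero_le _
  · exact le_rfl

theorem map_getD_range (s : List ℕ) : (List.range s.length).map (fun j => s.getD j 0) = s := by
  refine List.ext_getElem (by simp) fun i h1 h2 => ?_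
  simp [h2]

theorem card_filter_colLen (μ : YoungDiagram) {k h b : ℕ} (hk : ∀ j, k ≤ j → μ.colLen j = 0)
    (hh : 1 ≤ h) (hb : μ.rowLen h ≤ b) :
    ((Finset.range k).filter fun j => μ.colLen j = h ∧ b ≤ j).card = μ.rowLen (h - 1) - b := by
  rw [← Nat.card_Ico]
  congr 1
  ext j
  have h1 : j < μ.rowLen (h - 1) ↔ h - 1 < μ.colLen j := by
    rw [← YoungDiagram.mem_iff_lt_rowLen, YoungDiagram.mem_iff_lt_colLen]
  have h2 : j < μ.rowLen h ↔ h < μ.colLen j := by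
    rw [← YoungDiagram.mem_iff_lt_rowLen, YoungDiagram.mem_iff_lt_colLen]
  have h3 := hk j
  simp only [Finset.mem_filter, Finset.mem_range, Finset.mem_Ico]
  omega

theorem numMid_le_count {n : ℕ} {l : List ColData} (h : ∀ d ∈ l, d.mid = n → d.gap = n) :
    numMid n l ≤ (heights l).count n := by
  induction l with
  | nil => simp [numMid]
  | cons d l ih =>
    have := ih fun d hd => h d (by simp [hd])
    have h2 := h d (by simp)
    rw [numMid_cons, heights_cons, List.count_append, List.count_cons]
    simp only [beq_iff_eq]
    split_ifs <;> omega

/-- Columns with suitable heights come from a `±`-diagram. -/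
theorem exists_pmDiagram {X : ClassicalType} {n r k : ℕ} {l : List ColData} (hn : 1 ≤ n) (hl : Good l)
    (hk : l.length = k)
    (hr : ∀ d ∈ l, d.col.length ≤ r ∧ d.col.length ≡ r [MOD 2]) (hrn : r ≤ n)
    (hgapn : ∀ d ∈ l, d.mid = n → d.gap = n)
    (hlen : (l.map fun d => d.col.length).Pairwise (· ≥ ·))
    (hcount : ∀ h, 1 ≤ h → (heights l).count h ≤ numMid h l) :
    ∃ P : PMDiagram, P.IsOfType X n ∧ P.OuterMem r k ∧ tab l = P.Phi n k := by
  set mids := l.map ColData.mid with hmids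
  set lens := l.map fun d => d.col.length with hlens
  have hmidsk : mids.length = k := by simp [hmids, hk]
  have hlensk : lens.length = k := by simp [hlens, hk]
  have hm : Antitone fun j => mids.getD j 0 := antitone_getD (by
    rw [hmids, List.pairwise_map]; exact hl.mid_anti)
  have ho : Antitone fun j => lens.getD j 0 := antitone_getD hlen
  have hm0 : ∀ j, k ≤ j → mids.getD j 0 = 0 := fun j hj =>
    List.getD_eq_default _ _ (by omega)
  have ho0 : ∀ j, k ≤ j → lens.getD j 0 = 0 := fun j hj =>
    List.getD_eq_default _ _ (by omega)
  have hmget : ∀ j (hj : j < l.length), mids.getD j 0 = l[j].mid := by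
    intro j hj
    rw [List.getD_eq_getElem _ _ (by omega)]
    simp [hmids]
  have hoget : ∀ j (hj : j < l.length), lens.getD j 0 = l[j].mid + l[j].bar.toList.length := by
    intro j hj
    rw [List.getD_eq_getElem _ _ (by omega)]
    simp [hlens, length_col]
  have hbarlen : ∀ d : ColData, d.bar.toList.length ≤ 1 := by
    rintro ⟨_, _, _ | _⟩ <;> simp
  set μ := youngOfColLens (fun j => mids.getD j 0) k hm with hμ
  have hμc : ∀ j, μ.colLen j = mids.getD j 0 := colLen_youngOfColLens _ k hm hm0
  have hμ0 : ∀ j, k ≤ j → μ.colLen j = 0 := fun j hj => by rw [hμc, hm0 j hj]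
  have hnum : ∀ h, 1 ≤ h → numMid h l = μ.rowLen (h - 1) - μ.rowLen h := by
    intro h hh
    rw [← card_filter_colLen μ hμ0 hh le_rfl, numMid_eq_count, ← hmids, ← map_getD_range mids,
      hmidsk, List.count, countP_map_range, Finset.card_filter]
    refine Finset.sum_congr rfl fun j hj => ?_
    simp only [beq_iff_eq, hμc]
    have h2 : j < μ.rowLen h ↔ h < μ.colLen j := by
      rw [← YoungDiagram.mem_iff_lt_rowLen, YoungDiagram.mem_iff_lt_colLen]
    rw [hμc] at h2
    split_ifs <;> omega
  -- the columns that carry a `+`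
  obtain ⟨plus, hplusdef⟩ : ∃ plus : ℕ → Prop, ∀ j, plus j ↔ 1 ≤ mids.getD j 0 ∧
      μ.rowLen (mids.getD j 0 - 1) - (heights l).count (mids.getD j 0) ≤ j :=
    ⟨_, fun _ => Iff.rfl⟩
  classical
  have hi : Antitone fun j => mids.getD j 0 - if plus j then 1 else 0 := by
    intro j j' hj
    have h1 : mids.getD j' 0 ≤ mids.getD j 0 := hm hj
    dsimp only
    rcases h1.lt_or_eq with h1 | h1
    · split_ifs <;> omega
    · have : plus j → plus j' := by
        rw [hplusdef, hplusdef, h1]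
        omega
      split_ifs <;> first | omega | tauto
  have hi0 : ∀ j, k ≤ j → (mids.getD j 0 - if plus j then 1 else 0) = 0 := fun j hj => by
    have := hm0 j hj
    split_ifs <;> omega
  have hμo := colLen_youngOfColLens _ k ho ho0
  have hμi := colLen_youngOfColLens _ k hi hi0
  have hmo : ∀ j, mids.getD j 0 ≤ lens.getD j 0 ∧ lens.getD j 0 ≤ mids.getD j 0 + 1 := by
    intro j
    by_cases hj : j < l.length
    · have := hbarlen l[j]
      rw [hmget j hj, hoget j hj]
      omega
    · rw [hm0 j (by omega), ho0 j (by omega)]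
      omega
  let P : PMDiagram :=
    { inner := youngOfColLens _ k hi
      mid := μ
      outer := youngOfColLens _ k ho
      inner_le_mid := youngDiagram_le_of_colLen_le fun j => by
        rw [hμi, hμc]; exact Nat.sub_le _ _
      mid_le_outer := youngDiagram_le_of_colLen_le fun j => by
        rw [hμo, hμc]; exact (hmo j).1
      plus_strip := fun j => by
        rw [hμi, hμc]; split_ifs <;> omega
      minus_strip := fun j => by
        rw [hμo, hμc]; exact (hmo j).2 }
  have hPo : ∀ j, P.outer.colLen j = lens.getD j 0 := hμo
  have hPm : ∀ j, P.mid.colLen j = mids.getD j 0 := hμc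
  have hPi : ∀ j, P.inner.colLen j = mids.getD j 0 - if plus j then 1 else 0 := hμi
  have hplus : ∀ j, P.inner.colLen j < P.mid.colLen j ↔ plus j := by
    intro j
    rw [hPi, hPm]
    constructor
    · intro h
      by_contra hc
      simp [hc] at h
    · intro h
      have := ((hplusdef j).mp h).1
      rw [if_pos h]
      omega
  -- a column of height `n` in the middle shape carries a `+`
  have hfix : ∀ j, P.mid.colLen j = n → P.inner.colLen j < P.mid.colLen j := by
    intro j hj
    rw [hplus, hplusdef]
    rw [hPm] at hj
    refine ⟨by omega, ?_⟩
    rw [hj]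
    have h1 := numMid_le_count hgapn
    have h2 := hnum n hn
    have h3 : ¬ j < μ.rowLen n := by
      rw [← YoungDiagram.mem_iff_lt_rowLen, YoungDiagram.mem_iff_lt_colLen, hμc]
      omega
    omega
  have hPok : ∀ j, P.outer.colLen j ≤ r := by
    intro j
    rw [hPo]
    by_cases hj : j < l.length
    · have := (hr l[j] (List.getElem_mem hj)).1
      rwa [length_col, ← hoget j hj] at this
    · rw [ho0 j (by omega)]
      exact Nat.zero_le _
  refine ⟨P, ?_, ⟨?_, ?_⟩, ?_⟩
  · intro _ j
    have h1 := hPok j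
    refine ⟨h1.trans hrn, ?_⟩
    have h2 := hmo j
    have h3 := hfix j
    have h4 := YoungDiagram.colLen_mono P.inner_le_mid j
    rw [← hPo, ← hPm] at h2
    omega
  · intro j hj
    refine ⟨hPok j, ?_⟩
    have hj : j < l.length := by omega
    have := (hr l[j] (List.getElem_mem hj)).2
    rwa [length_col, ← hoget j hj, ← hPo] at this
  · intro j hj
    rw [hPo, ho0 j hj]
  · have hpos : plusList n (P.columnHeights k) =
        (heights l).filter fun x => 0 < x ∧ x ≠ n := by
      refine List.Perm.eq_of_pairwise (le := fun a b : ℕ => a ≥ b)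
        (fun a b _ _ h1 h2 => le_antisymm h2 h1) ?_ (hl.heights_anti.filter _) ?_
      · unfold plusList columnHeights
        rw [List.pairwise_map]
        refine List.Pairwise.filter _ ?_
        rw [List.pairwise_map]
        exact List.pairwise_lt_range.imp fun h => P.mid.colLen_anti _ _ h.le
      · rw [List.perm_iff_count]
        intro h
        by_cases hh : 0 < h ∧ h ≠ n
        · rw [List.count_filter (by simpa using hh), plusList, List.count, List.countP_map,
            List.countP_filter, columnHeights, countP_map_range]
          have h1 := hnum h hh.1
          have h1' := μ.rowLen_anti _ _ (Nat.sub_le h 1)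
          have h2 := hcount h hh.1
          have h3 := card_filter_colLen μ (b := μ.rowLen (h - 1) - (heights l).count h) hμ0 hh.1
            (by omega)
          have h4 : (heights l).count h =
              ∑ j ∈ Finset.range k, if μ.colLen j = h ∧
                μ.rowLen (h - 1) - (heights l).count h ≤ j then 1 else 0 := by
            rw [← Finset.card_filter, h3]
            omega
          refine Eq.trans ?_ h4.symm
          refine Finset.sum_congr rfl fun j _ => if_congr ?_ rfl rfl
          simp only [Function.comp_apply, Bool.and_eq_true, beq_iff_eq, decide_eq_true_eq, hplus]
          rw [hplusdef, hPm]
          constructor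
          · rintro ⟨rfl, ⟨-, h5⟩, -⟩
            exact ⟨rfl, h5⟩
          · rintro ⟨rfl, h5⟩
            exact ⟨rfl, ⟨hh.1, h5⟩, hh.2⟩
        · rw [List.count_eq_zero.mpr, List.count_eq_zero.mpr]
          · intro hmem
            exact hh (by simpa using (List.mem_filter.mp hmem).2)
          · intro hmem
            have := mem_plusList hmem
            exact hh ⟨this.1, this.2.1⟩
    rw [P.Phi_eq, hpos]
    refine (phiAux_eq_tab ?_ hl ?_).symm
    · rw [List.forall₂_iff_get]
      refine ⟨by simp [columnHeights, hk], fun j h1 h2 => ?_⟩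
      simp only [columnHeights, List.get_eq_getElem, List.getElem_map, List.getElem_range]
      have h3 := hmget j h1
      have h4 := hoget j h1
      rw [← hPm] at h3
      rw [← hPo] at h4
      exact ⟨h3, h4, fun h => hfix j (h3.trans h)⟩
    · intro d hd
      have h1 := (hr d hd).1
      rw [length_col] at h1
      refine ⟨by omega, fun h => ⟨hgapn d hd h, ?_⟩⟩
      rcases hb : d.bar with _ | g
      · rfl
      · rw [hb] at h1
        simp at h1
        omega

end KRCrystal

namespace KRCrystal

open ColData

theorem pairwise_length_ge {X : ClassicalType} {n : ℕ} {T : Tableau}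
    (hT : T.IsChain (IsKNPair X n)) : (T.map List.length).Pairwise (· ≥ ·) := by
  rw [← List.isChain_iff_pairwise, List.isChain_map]
  exact hT.imp fun _ _ h => h.1

/-- A tableau of `B^{r,k}` that is killed by `e_2, …, e_n` is the tableau of a `±`-diagram. -/
theorem exists_pmDiagram_of_leviHighest {X : ClassicalType} {n r k : ℕ} (hn : 2 ≤ n)
    (hrn : r ≤ maxRow X n) {T : Tableau} (hT : T ∈ KR X n r k)
    (hhigh : LeviHighest X n T.word) :
    ∃ P : PMDiagram, P.IsOfType X n ∧ P.OuterMem r k ∧ T = P.Phi n k := by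
  obtain ⟨l, rfl, hl⟩ := exists_good_of_leviHighest hn hT.2.2
    (fun C hC => (hT.2.1 C hC).1.trans hrn) hhigh
  have hmem : ∀ d ∈ l, d.col ∈ tab l := fun d hd => List.mem_map_of_mem hd
  refine exists_pmDiagram (by omega) hl (by simpa [tab] using hT.1)
    (fun d hd => hT.2.1 _ (hmem d hd)) (hrn.trans (maxRow_le X n)) ?_ ?_
    (fun h hh => count_heights_le hn hrn hT hl hhigh hh)
  · intro d hd hdn
    by_contra hne
    have hgap := hl.gap_le d hd
    have h1 := getElem?_col (d := d) (j := n - 1) (by omega)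
    rw [if_neg (by omega)] at h1
    have h2 : 1 ≤ n - 1 + 2 ∧ n - 1 + 2 ≤ n :=
      (hT.2.2.1 _ (hmem d hd)).1 _ (List.mem_of_getElem? h1)
    omega
  · have h := pairwise_length_ge hT.2.2.2
    rwa [tab, List.map_map] at h

end KRCrystal

theorem proposition3p2 (X : KRCrystal.ClassicalType) (n r k l : ℕ) (hn : 2 ≤ n)
    (hr : 1 ≤ r) (hrn : r ≤ KRCrystal.maxRow X n) (hk : 1 ≤ k) (hl : 1 ≤ l)
    (b b' : KRCrystal.Tableau) (hb : b ∈ KRCrystal.KR X n 1 l) (hb' : b' ∈ KRCrystal.KR X n r k) :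
    KRCrystal.IsClassicallyHighest X n b b' ↔
      b = KRCrystal.oneRow l ∧
      ∃ P : KRCrystal.PMDiagram, P.IsOfType X n ∧ P.OuterMem r k ∧ b' = P.Phi n k ∧
        (∑ i ∈ (Finset.Icc 1 r).filter (fun i => i ≡ r [MOD 2]), (P.numEmpty i + P.numMinus i)) +
        (∑ i ∈ (Finset.Ioc 1 r).filter (fun i => i ≡ r [MOD 2]), (P.numMinus i + P.numBoth i)) ≤
          l := by
  have hD : X = .D → 3 ≤ n := by
    rintro rfl
    simp only [KRCrystal.maxRow] at hrn
    omega
  rw [KRCrystal.isClassicallyHighest_iff]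
  constructor
  · intro h
    obtain rfl := KRCrystal.eq_oneRow_of_highest X hn hb fun i hi hin => (h i hi hin).1
    have h' : ∀ i, 1 ≤ i → i ≤ n → (KRCrystal.Crystal.wordLengths (KRCrystal.letterEps X n i)
        (KRCrystal.letterPhi X n i) b'.word).1 ≤ if i = 1 then l else 0 := by
      intro i hi hin
      have := (h i hi hin).2
      rwa [KRCrystal.word_oneRow, KRCrystal.wordLengths_replicate_one X hn hi hin hD] at this
    refine ⟨rfl, ?_⟩
    have hhigh : KRCrystal.LeviHighest X n b'.word := by
      intro i hi hin
      have := h' i (by omega) hin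
      rwa [if_neg (by omega), Nat.le_zero] at this
    obtain ⟨P, hP1, hP2, rfl⟩ := KRCrystal.exists_pmDiagram_of_leviHighest hn hrn hb' hhigh
    refine ⟨P, hP1, hP2, rfl, ?_⟩
    obtain ⟨L, hL, hgap, hs, -, hz⟩ := P.exists_colData_Phi hn hrn hP1 hP2
    have h1 := h' 1 le_rfl (by omega)
    rw [if_pos rfl, hL, KRCrystal.wordLengths_fst_le_iff_coeff X (by omega)] at h1
    have h2 := KRCrystal.ColData.count_le_of_neg_le_coeff (h := 0) (k := l) hs hgap h1
    change P.level r ≤ l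
    omega
  · rintro ⟨rfl, P, hP1, hP2, rfl, hle⟩ i hi hin
    change P.level r ≤ l at hle
    obtain ⟨L, hL, hgap, -, hb1, hz⟩ := P.exists_colData_Phi hn hrn hP1 hP2
    rw [KRCrystal.word_oneRow, KRCrystal.wordLengths_replicate_one X hn hi hin hD, hL]
    rw [hL] at hb'
    exact ⟨rfl, KRCrystal.wordLengths_tab_le hn hD hb' hgap hb1 (by omega) hi hin⟩
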